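/- For $n\ge 1$ let $X_n,Y_n$ be independent random matrices from the Gaussian Unitary Ensemble of size $n$, normalised so that the diagonal entries are real standard Gaussians, the entries above the diagonal are complex Gaussians whose real and imaginary parts are independent centred Gaussians of variance $1/2$, all of these are independent, and the matrix is Hermitian. For $t\in[0,1]$ let \[A_{n,t}=\sqrt{\tfrac{1+t}{2}}\,X_n+i\sqrt{\tfrac{1-t}{2}}\,Y_n\] (the Elliptic Ginibre Ensemble), let $\mathbb D=\{z\in\mathbb C:|z|<1\}$, and for $z\in\mathbb D$ set \[f_{n,t}(z)=\det\Bigl(1+tz^2-\frac{z}{\sqrt n}A_{n,t}\Bigr)\,e^{-ntz^2/2}.\] Fix $t\in(0,1]$. Then: 1. For every $n\ge 1$ and $z\in\mathbb D$ the second moment $\mathbb E[|f_{n,t}(z)|^2]$ is finite, and there is a continuous function $\mathcal F:\mathbb D\setminus\{0\}\to(0,\infty)$ such that $\mathbb E[|f_{n,t}(z)|^2]\to\mathcal F(z)$ as $n\to\infty$, uniformly for $z$ in any compact subset of $\mathbb D\setminus\{0\}$. 2. For every $r\in[0,1)$ there is a constant $C_r>0$ such that, for every $n\ge 1$, \[\mathbb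 E\Bigl[\sup_{|z|\le r}|f_{n,t}(z)|^2\Bigr]\le C_r .\] -/

import Mathlib

open MeasureTheory ProbabilityTheory Filter Topology

noncomputable section

namespace EllipticGinibre

/-- The product (entrywise Borel) sigma-algebra on complex `n × n` matrices. -/
instance matrixMeasurableSpace (n : ℕ) : MeasurableSpace (Matrix (Fin n) (Fin n) ℂ) :=
  inferInstanceAs (MeasurableSpace (Fin n → Fin n → ℂ))

/-- The `n × n` Hermitian matrix built from `n²` real numbers: the diagonal entries are `g i i`,
and for `i < j` the entry `(i, j)` is `(g i j + i g j i) / √2`. -/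
def hermitianOfReal (n : ℕ) (g : Fin n → Fin n → ℝ) : Matrix (Fin n) (Fin n) ℂ :=
  Matrix.of fun i j =>
    if i < j then ((g i j : ℂ) + Complex.I * (g j i : ℂ)) / (√2 : ℝ)
    else if j < i then ((g j i : ℂ) - Complex.I * (g i j : ℂ)) / (√2 : ℝ)
    else (g i i : ℂ)

/-- The law of the Gaussian Unitary Ensemble of size `n`, normalised so that every entry has
`E |X i j|² = 1`: the diagonal entries are standard real Gaussians, the entries above the diagonal
are standard complex Gaussians (independent real and imaginary parts of variance `1/2`), and all
of these are independent. -/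
def gueLaw (n : ℕ) : Measure (Matrix (Fin n) (Fin n) ℂ) :=
  (Measure.pi fun _ : Fin n => Measure.pi fun _ : Fin n => gaussianReal 0 1).map
    (hermitianOfReal n)

/-- The matrix `√((1+t)/2) X + i √((1-t)/2) Y`. -/
def ellipticCombination (n : ℕ) (t : ℝ)
    (p : Matrix (Fin n) (Fin n) ℂ × Matrix (Fin n) (Fin n) ℂ) : Matrix (Fin n) (Fin n) ℂ :=
  ((√((1 + t) / 2) : ℝ) : ℂ) • p.1 + (Complex.I * ((√((1 - t) / 2) : ℝ) : ℂ)) • p.2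

/-- The law of the Elliptic Ginibre Ensemble of size `n` with parameter `t`: the law of
`√((1+t)/2) X + i √((1-t)/2) Y` for `X`, `Y` independent with the GUE law. -/
def egeLaw (n : ℕ) (t : ℝ) : Measure (Matrix (Fin n) (Fin n) ℂ) :=
  ((gueLaw n).prod (gueLaw n)).map (ellipticCombination n t)

/-- The normalised characteristic polynomial
`f_{n,t}(z) = det (1 + t z² - (z / √n) A) exp (- n t z² / 2)` of the matrix `A`. -/
def normCharPoly (n : ℕ) (t : ℝ) (A : Matrix (Fin n) (Fin n) ℂ) (z : ℂ) : ℂ :=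
  ((1 + (t : ℂ) * z ^ 2) • (1 : Matrix (Fin n) (Fin n) ℂ) - (z / ((√(n : ℝ) : ℝ) : ℂ)) • A).det *
    Complex.exp (-((n : ℂ) * (t : ℂ) * z ^ 2) / 2)

lemma measurable_hermitianOfReal (n : ℕ) : Measurable (hermitianOfReal n) := by
  refine measurable_pi_lambda _ fun i => measurable_pi_lambda _ fun j => ?_
  simp only [hermitianOfReal, Matrix.of_apply]
  split_ifs <;> fun_prop

lemma measurable_ellipticCombination (n : ℕ) (t : ℝ) : Measurable (ellipticCombination n t) := by
  refine measurable_pi_lambda _ fun i => measurable_pi_lambda _ fun j => ?_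
  have h : Measurable fun M : Matrix (Fin n) (Fin n) ℂ => M i j :=
    (measurable_pi_apply (X := fun _ : Fin n => ℂ) j).comp
      (measurable_pi_apply (X := fun _ : Fin n => Fin n → ℂ) i)
  exact ((h.comp measurable_fst).const_mul _).add ((h.comp measurable_snd).const_mul _)

instance isProbabilityMeasure_gueLaw (n : ℕ) : IsProbabilityMeasure (gueLaw n) :=
  Measure.isProbabilityMeasure_map (measurable_hermitianOfReal n).aemeasurable

instance isProbabilityMeasure_egeLaw (n : ℕ) (t : ℝ) : IsProbabilityMeasure (egeLaw n t) :=
  Measure.isProbabilityMeasure_map (measurable_ellipticCombination n t).aemeasurable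

end EllipticGinibre

end

/-!
Expand `E[det(u - A) conj(det(v - A))]` over pairs of permutations. The entries of `A` on the
diagonal and the mirror pairs `A i j, A j i` are independent blocks, so each pair contributes a
product of block weights which are polynomials in `u`, `v` and in the covariances
`t = E[A i j A j i]` and `t'` of the two factors. Differentiating twice in `u` deletes two fixed
points, differentiating in `t` deletes a transposition, and these have opposite signs: the moment
solves the heat equation `2 ∂_t = -∂_u²`, and likewise in `(t', v)`. Hence it is determined by its
value `∑ n! / k! (u v)^k` at `t = t' = 0`, and is the truncated Mehler sum
`∑ n! / k! He_k(u) He_k(v)` of rescaled Hermite polynomials.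

At the point that corresponds to `z`, the Hermite values are Taylor coefficients of
`w ↦ exp (n (w - a (w - 1)² / 2))` with `a = t z²`. Cauchy's formula on a circle of nearly critical
radius bounds the term of degree `n - j` by a constant times `|z|^(2j)`; on the unit circle,
Laplace's method at the saddle point `w = 1` shows that it tends to `|z|^(2j) / |1 - a|`. By
dominated convergence the second moment tends to `1 / ((1 - |z|²) |1 - t z²|)`, uniformly on compact
sets because the convergence holds along convergent sequences of points.

The squared modulus of the holomorphic function `f` is subharmonic, so its supremum over a disc is
controlled by its averages over a larger circle, whose expectation is bounded by the same geometric
series.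
-/

noncomputable section

namespace EllipticGinibre

section Hermite

variable {R S 𝕜 : Type*} [CommRing R] [CommRing S] [CommRing 𝕜] [Algebra 𝕜 R]

/-- The monic Hermite polynomials with variance parameter `t`, evaluated at `u`; their exponential
generating function is `exp (u s - t s² / 2)`. -/
def hermiteVar (t u : R) : ℕ → R
  | 0 => 1
  | 1 => u
  | k + 2 => u * hermiteVar t u (k + 1) - (k + 1) * t * hermiteVar t u k

lemma hermiteVar_add_two (t u : R) (k : ℕ) :
    hermiteVar t u (k + 2) = u * hermiteVar t u (k + 1) - (k + 1) * t * hermiteVar t u k := rfl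

lemma map_hermiteVar {F : Type*} [FunLike F R S] [RingHomClass F R S] (f : F) (t u : R) : ∀ k,
    f (hermiteVar t u k) = hermiteVar (f t) (f u) k
  | 0 => by simp [hermiteVar]
  | 1 => by simp [hermiteVar]
  | k + 2 => by simp [hermiteVar, map_hermiteVar f t u k, map_hermiteVar f t u (k + 1)]

lemma hermiteVar_zero_left (u : R) : ∀ k, hermiteVar 0 u k = u ^ k
  | 0 => by simp [hermiteVar]
  | 1 => by simp [hermiteVar]
  | k + 2 => by simp [hermiteVar, hermiteVar_zero_left u (k + 1)]; ring

lemma hermiteVar_scale (c t u : R) : ∀ k,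
    hermiteVar (c ^ 2 * t) (c * u) k = c ^ k * hermiteVar t u k
  | 0 => by simp [hermiteVar]
  | 1 => by simp [hermiteVar]
  | k + 2 => by
    simp only [hermiteVar, hermiteVar_scale c t u k, hermiteVar_scale c t u (k + 1)]; ring

lemma derivation_hermiteVar_succ (D : Derivation 𝕜 R R) {t u : R} (ht : D t = 0) (hu : D u = 1) :
    ∀ k, D (hermiteVar t u (k + 1)) = (k + 1) * hermiteVar t u k
  | 0 => by simp [hermiteVar, hu]
  | 1 => by simp [hermiteVar, hu, ht]; ring
  | k + 2 => by
    have h₁ := derivation_hermiteVar_succ D ht hu (k + 1)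
    have h₂ := derivation_hermiteVar_succ D ht hu k
    rw [hermiteVar_add_two]
    simp only [map_sub, Derivation.leibniz, smul_eq_mul, hu, ht, map_add, D.map_natCast,
      D.map_one_eq_zero, h₁, h₂]
    push_cast
    rw [hermiteVar_add_two t u k]
    ring

lemma derivation_hermiteVar_add_two (D : Derivation 𝕜 R R) {t u : R} (ht : D t = 1)
    (hu : D u = 0) :
    ∀ k, 2 * D (hermiteVar t u (k + 2)) = -((k + 1) * (k + 2) * hermiteVar t u k)
  | 0 => by simp [hermiteVar, hu, ht]
  | 1 => by simp [hermiteVar, hu, ht]; ring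
  | k + 2 => by
    have h₁ := derivation_hermiteVar_add_two D ht hu (k + 1)
    have h₂ := derivation_hermiteVar_add_two D ht hu k
    rw [hermiteVar_add_two]
    simp only [map_sub, Derivation.leibniz, smul_eq_mul, hu, ht, map_add, D.map_natCast,
      D.map_one_eq_zero]
    push_cast at h₁ ⊢
    linear_combination u * h₁ - ((k : R) + 3) * t * h₂ +
      ((k : R) + 2) * (k + 3) * hermiteVar_add_two t u k

lemma hermiteVar_heat (Dt Du : Derivation 𝕜 R R) {t u : R} (htt : Dt t = 1) (htu : Dt u = 0)
    (hut : Du t = 0) (huu : Du u = 1) :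
    ∀ k, 2 * Dt (hermiteVar t u k) = -Du (Du (hermiteVar t u k))
  | 0 => by simp [hermiteVar]
  | 1 => by simp [hermiteVar, htu, huu]
  | k + 2 => by
    rw [derivation_hermiteVar_add_two Dt htt htu, derivation_hermiteVar_succ Du hut huu (k + 1)]
    simp only [Derivation.leibniz, derivation_hermiteVar_succ Du hut huu k, smul_eq_mul,
      Du.map_natCast, map_add, Du.map_one_eq_zero]
    push_cast
    ring

end Hermite

section HeatUniqueness

open MvPolynomial

variable {R : Type*} [CommRing R]

lemma coeff_aeval_zero_X (P : MvPolynomial (Fin 2) R) {m : Fin 2 →₀ ℕ} (hm : m 0 = 0) :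
    coeff m (aeval ![0, X 1] P : MvPolynomial (Fin 2) R) = coeff m P := by
  induction P using MvPolynomial.induction_on' with
  | add p q hp hq => rw [map_add, coeff_add, coeff_add, hp, hq]
  | monomial s a =>
    rw [aeval_monomial]
    by_cases hs : s 0 = 0
    · rw [monomial_eq, Finsupp.prod_fintype _ _ (by simp), Finsupp.prod_fintype _ _ (by simp)]
      simp [hs, algebraMap_eq]
    · have hsm : s ≠ m := fun h => hs (h ▸ hm)
      simp [coeff_monomial, hsm, Finsupp.prod_fintype, hs]

variable [IsDomain R] [CharZero R]

lemma eq_zero_of_heat {P : MvPolynomial (Fin 2) R} (hP : 2 * pderiv 0 P = -pderiv 1 (pderiv 1 P))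
    (h₀ : (aeval ![0, X 1] P : MvPolynomial (Fin 2) R) = 0) : P = 0 := by
  suffices ∀ (k : ℕ) (m : Fin 2 →₀ ℕ), m 0 = k → coeff m P = 0 by
    ext m
    simpa using this _ m rfl
  intro k
  induction k with
  | zero => intro m hm; rw [← coeff_aeval_zero_X P hm, h₀, coeff_zero]
  | succ k ih =>
    intro m hm
    obtain ⟨m, rfl⟩ : ∃ m', m = m' + Finsupp.single 0 1 :=
      ⟨m - Finsupp.single 0 1, (tsub_add_cancel_of_le (by simp [hm])).symm⟩
    have hcoeff := congrArg (coeff m) hP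
    rw [← map_ofNat C 2, coeff_C_mul, coeff_neg, coeff_pderiv, coeff_pderiv, coeff_pderiv,
      ih (m + Finsupp.single 1 1 + Finsupp.single 1 1) (by simpa using hm)] at hcoeff
    simpa [Nat.cast_add_one_ne_zero] using hcoeff

lemma eq_sum_hermiteVar_of_heat {P : MvPolynomial (Fin 2) R}
    (hP : 2 * pderiv 0 P = -pderiv 1 (pderiv 1 P)) (n : ℕ) (c : ℕ → R)
    (h₀ : (aeval ![0, X 1] P : MvPolynomial (Fin 2) R) = ∑ k ∈ Finset.range n, C (c k) * X 1 ^ k) :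
    P = ∑ k ∈ Finset.range n, C (c k) * hermiteVar (X 0) (X 1) k := by
  rw [← sub_eq_zero]
  apply eq_zero_of_heat
  · have hheat (k : ℕ) := hermiteVar_heat (pderiv 0) (pderiv 1) (pderiv_X_self (R := R) (0 : Fin 2))
      (pderiv_X_of_ne (by decide)) (pderiv_X_of_ne (by decide)) (pderiv_X_self 1) k
    simp only [map_sub, map_sum, pderiv_C_mul, mul_sub, hP, Finset.mul_sum,
      mul_left_comm (2 : MvPolynomial (Fin 2) R), hheat, mul_neg, Finset.sum_neg_distrib]
    ring
  · rw [map_sub, h₀, sub_eq_zero, map_sum]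
    refine Finset.sum_congr rfl fun k _ => ?_
    rw [map_mul, map_hermiteVar]
    simp [hermiteVar_zero_left]

end HeatUniqueness

section UpperPairs

variable {ι M : Type*} [Fintype ι] [LinearOrder ι] [CommMonoid M]

variable (ι) in
/-- The pairs `(i, j)` with `i < j`. -/
def upperPairs : Finset (ι × ι) := {p | p.1 < p.2}

lemma mem_upperPairs {p : ι × ι} : p ∈ upperPairs ι ↔ p.1 < p.2 := by simp [upperPairs]

@[to_additive]
lemma prod_eq_prod_diag_mul_prod_upperPairs (f : ι → ι → M) :
    ∏ i, ∏ j, f i j = (∏ i, f i i) * ∏ p ∈ upperPairs ι, f p.1 p.2 * f p.2 p.1 := by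
  have hsplit (i j : ι) : f i j = (if i = j then f i j else 1) *
      ((if i < j then f i j else 1) * if j < i then f i j else 1) := by
    rcases lt_trichotomy i j with h | rfl | h
    · simp [h, h.ne, h.not_gt]
    · simp
    · simp [h, h.ne', h.not_gt]
  have hupper (g : ι → ι → M) :
      ∏ i, ∏ j, (if i < j then g i j else 1) = ∏ p ∈ upperPairs ι, g p.1 p.2 := by
    rw [upperPairs, Finset.prod_filter, Fintype.prod_prod_type]
  calc ∏ i, ∏ j, f i j
      = (∏ i, ∏ j, if i = j then f i j else 1) * ((∏ i, ∏ j, if i < j then f i j else 1) *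
          ∏ i, ∏ j, if j < i then f i j else 1) := by
        simp only [← Finset.prod_mul_distrib, ← hsplit]
    _ = _ := by
        rw [hupper, Finset.prod_comm (f := fun i j => if j < i then f i j else 1),
          hupper fun i j => f j i, ← Finset.prod_mul_distrib]
        simp

end UpperPairs

section BlockProducts

variable {ι A : Type*} [Fintype ι] [LinearOrder ι] [CommRing A]

/-- A product over the blocks `{(i, i)}` and `{(i, j), (j, i)}`, `i < j`, of an `ι × ι` array: each
factor `d i` or `w (i, j)` depends on which of the entries of its block belong to the relation
`e`. -/
def blockProd (d : ι → Bool → A) (w : ι × ι → Bool → Bool → A) (e : ι → ι → Bool) : A :=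
  (∏ i, d i (e i i)) * ∏ p ∈ upperPairs ι, w p (e p.1 p.2) (e p.2 p.1)

/-- The graph `{(i, σ i)}` of a permutation. -/
def permGraph (σ : Equiv.Perm ι) (i j : ι) : Bool := decide (σ i = j)

/-- The signed sum over permutations of the block products of their graphs; the determinant of a
matrix and its expectations have this form. -/
def signedBlockSum (d : ι → Bool → A) (w : ι × ι → Bool → Bool → A) : A :=
  ∑ σ : Equiv.Perm ι, ((Equiv.Perm.sign σ : ℤ) : A) * blockProd d w (permGraph σ)

lemma prod_perm_eq_blockProd (M : Matrix ι ι A) (σ : Equiv.Perm ι) :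
    ∏ i, M (σ i) i = blockProd (fun i b => if b then M i i else 1)
      (fun p b c => (if b then M p.2 p.1 else 1) * if c then M p.1 p.2 else 1) (permGraph σ) := by
  have hrow (i : ι) : M (σ i) i = ∏ j, if permGraph σ i j then M j i else 1 := by
    simp [permGraph]
  simp only [hrow, prod_eq_prod_diag_mul_prod_upperPairs, blockProd]

lemma det_eq_signedBlockSum (M : Matrix ι ι A) :
    M.det = signedBlockSum (fun i b => if b then M i i else 1)
      (fun p b c => (if b then M p.2 p.1 else 1) * if c then M p.1 p.2 else 1) := by
  simp only [Matrix.det_apply', prod_perm_eq_blockProd, signedBlockSum]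

end BlockProducts

section BlockHeat

variable {ι A 𝕜 : Type*} [CommRing 𝕜] [CommRing A] [Algebra 𝕜 A]

lemma derivation_prod [DecidableEq ι] (D : Derivation 𝕜 A A) (s : Finset ι) (f : ι → A) :
    D (∏ i ∈ s, f i) = ∑ i ∈ s, (∏ j ∈ s.erase i, f j) * D (f i) := by
  induction s using Finset.induction_on with
  | empty => simp
  | insert a s ha ih =>
    rw [Finset.prod_insert ha, Derivation.leibniz, Finset.sum_insert ha, Finset.erase_insert ha,
      ih, smul_eq_mul, smul_eq_mul, Finset.mul_sum, add_comm]
    congr 1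
    refine Finset.sum_congr rfl fun i hi => ?_
    have hai : a ≠ i := fun h => ha (h ▸ hi)
    rw [Finset.erase_insert_of_ne hai, Finset.prod_insert (by simp [ha])]
    ring

variable [LinearOrder ι]

/-- The relation `e` with the pairs starting at `i` removed. -/
def eraseRow (e : ι → ι → Bool) (i : ι) : ι → ι → Bool := fun a b => e a b && (a ≠ i)

lemma eraseRow_eraseRow_permGraph_mul_swap {σ : Equiv.Perm ι} (i j : ι) :
    eraseRow (eraseRow (permGraph (σ * Equiv.swap i j)) i) j =
      eraseRow (eraseRow (permGraph σ) i) j := by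
  ext a b
  by_cases hi : a = i
  · simp [eraseRow, hi]
  by_cases hj : a = j
  · simp [eraseRow, hj]
  simp [eraseRow, permGraph, Equiv.swap_apply_of_ne_of_ne hi hj]

variable [Fintype ι] {d : ι → Bool → A} {w : ι × ι → Bool → Bool → A} {e : ι → ι → Bool}

lemma derivation_blockProd_diag (D : Derivation 𝕜 A A)
    (hd : ∀ i b, D (d i b) = if b then d i false else 0) (hw : ∀ p b c, D (w p b c) = 0)
    (he : ∀ a b c, e a b → e a c → b = c) :
    D (blockProd d w e) = ∑ i, if e i i then blockProd d w (eraseRow e i) else 0 := by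
  have hpairs : D (∏ p ∈ upperPairs ι, w p (e p.1 p.2) (e p.2 p.1)) = 0 := by
    simp [derivation_prod, hw]
  rw [blockProd, D.leibniz, hpairs, derivation_prod, smul_zero, zero_add, smul_eq_mul,
    Finset.mul_sum]
  refine Finset.sum_congr rfl fun i _ => ?_
  rw [hd]
  split_ifs with hi
  · have hdiag : ∏ k, d k (eraseRow e i k k) =
        (∏ k ∈ Finset.univ.erase i, d k (e k k)) * d i false := by
      rw [← Finset.prod_erase_mul _ _ (Finset.mem_univ i)]
      congr 1
      · refine Finset.prod_congr rfl fun k hk => ?_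
        simp [eraseRow, Finset.ne_of_mem_erase hk]
      · simp [eraseRow]
    have hpair (p : ι × ι) (hp : p ∈ upperPairs ι) :
        eraseRow e i p.1 p.2 = e p.1 p.2 ∧ eraseRow e i p.2 p.1 = e p.2 p.1 := by
      have := (mem_upperPairs.1 hp).ne
      have := he i
      grind [eraseRow]
    rw [blockProd, hdiag, mul_comm]
    congr 1
    refine Finset.prod_congr rfl fun p hp => ?_
    rw [(hpair p hp).1, (hpair p hp).2]
  · simp

lemma derivation_blockProd_pair (D : Derivation 𝕜 A A) (hd : ∀ i b, D (d i b) = 0)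
    (hw : ∀ p b c, D (w p b c) = if b && c then w p false false else 0)
    (he : ∀ a b c, e a b → e a c → b = c) :
    D (blockProd d w e) = ∑ p ∈ upperPairs ι,
      if e p.1 p.2 && e p.2 p.1 then blockProd d w (eraseRow (eraseRow e p.1) p.2) else 0 := by
  have hdiag : D (∏ i, d i (e i i)) = 0 := by simp [derivation_prod, hd]
  rw [blockProd, D.leibniz, hdiag, derivation_prod, smul_zero, add_zero, smul_eq_mul,
    Finset.mul_sum]
  refine Finset.sum_congr rfl fun p hp => ?_
  rw [hw]
  split_ifs with hpe
  · obtain ⟨_, _⟩ := Bool.and_eq_true_iff.1 hpe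
    have hp' := mem_upperPairs.1 hp
    have hother (q : ι × ι) (hq : q ∈ (upperPairs ι).erase p) :
        eraseRow (eraseRow e p.1) p.2 q.1 q.2 = e q.1 q.2 ∧
          eraseRow (eraseRow e p.1) p.2 q.2 q.1 = e q.2 q.1 := by
      obtain ⟨hqp, hq⟩ := Finset.mem_erase.1 hq
      rw [mem_upperPairs] at hq
      rw [Ne, Prod.ext_iff] at hqp
      have := he p.1 p.2
      have := he p.2 p.1
      grind [eraseRow]
    have hpairs : ∏ q ∈ upperPairs ι, w q (eraseRow (eraseRow e p.1) p.2 q.1 q.2)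
        (eraseRow (eraseRow e p.1) p.2 q.2 q.1) =
        (∏ q ∈ (upperPairs ι).erase p, w q (e q.1 q.2) (e q.2 q.1)) * w p false false := by
      rw [← Finset.prod_erase_mul _ _ hp]
      congr 1
      · exact Finset.prod_congr rfl fun q hq => by rw [(hother q hq).1, (hother q hq).2]
      · simp [eraseRow]
    have hdiag' (i : ι) : eraseRow (eraseRow e p.1) p.2 i i = e i i := by
      have := he p.1 p.2
      have := he p.2 p.1
      grind [eraseRow]
    simp only [blockProd, hpairs, hdiag']
  · simp

lemma derivation_derivation_blockProd_diag (D : Derivation 𝕜 A A)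
    (hd : ∀ i b, D (d i b) = if b then d i false else 0) (hw : ∀ p b c, D (w p b c) = 0)
    (he : ∀ a b c, e a b → e a c → b = c) :
    D (D (blockProd d w e)) = 2 * ∑ p ∈ upperPairs ι,
      if e p.1 p.1 && e p.2 p.2 then blockProd d w (eraseRow (eraseRow e p.1) p.2) else 0 := by
  have he' (i a b c : ι) (hb : eraseRow e i a b) (hc : eraseRow e i a c) : b = c :=
    he a b c (Bool.and_eq_true_iff.1 hb).1 (Bool.and_eq_true_iff.1 hc).1
  set g : ι → ι → A := fun i j =>
    if e i i && eraseRow e i j j then blockProd d w (eraseRow (eraseRow e i) j) else 0 with hg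
  have hsymm (i j : ι) : g j i = g i j := by
    have hcomm : eraseRow (eraseRow e j) i = eraseRow (eraseRow e i) j := by
      ext a b
      simp [eraseRow, Bool.and_right_comm]
    simp only [hg, hcomm]
    grind [eraseRow]
  calc D (D (blockProd d w e)) = ∑ i, ∑ j, g i j := by
        rw [derivation_blockProd_diag D hd hw he, map_sum]
        refine Finset.sum_congr rfl fun i _ => ?_
        by_cases hi : e i i
        · simp only [hi, if_true, derivation_blockProd_diag D hd hw (he' i), hg, Bool.true_and]
        · simp [hg, hi]
    _ = 2 * ∑ p ∈ upperPairs ι, g p.1 p.2 := by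
        rw [sum_eq_sum_diag_add_sum_upperPairs]
        simp only [hsymm, ← two_mul, Finset.mul_sum]
        simp [hg, eraseRow]
    _ = _ := by
        congr 1
        refine Finset.sum_congr rfl fun p hp => ?_
        have hp' := (mem_upperPairs.1 hp).ne'
        simp [hg, eraseRow, hp']

/-- The cancellation behind the heat equation: multiplication by `swap i j` exchanges the
permutations with the two-cycle `(i j)` and those fixing `i` and `j`, and reverses the sign. -/
lemma sum_sign_mul_blockProd_two_cycle {p : ι × ι} (hp : p.1 ≠ p.2) :
    ∑ σ : Equiv.Perm ι, ((Equiv.Perm.sign σ : ℤ) : A) *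
      (if permGraph σ p.1 p.2 && permGraph σ p.2 p.1 then
        blockProd d w (eraseRow (eraseRow (permGraph σ) p.1) p.2) else 0) =
    -∑ σ : Equiv.Perm ι, ((Equiv.Perm.sign σ : ℤ) : A) *
      (if permGraph σ p.1 p.1 && permGraph σ p.2 p.2 then
        blockProd d w (eraseRow (eraseRow (permGraph σ) p.1) p.2) else 0) := by
  rw [← Equiv.sum_comp (Equiv.mulRight (Equiv.swap p.1 p.2)), ← Finset.sum_neg_distrib]
  refine Finset.sum_congr rfl fun σ _ => ?_
  rw [Equiv.coe_mulRight, eraseRow_eraseRow_permGraph_mul_swap, Equiv.Perm.sign_mul,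
    Equiv.Perm.sign_swap hp]
  simp [permGraph, and_comm, neg_ite]

theorem signedBlockSum_heat (Dt Du : Derivation 𝕜 A A) (htd : ∀ i b, Dt (d i b) = 0)
    (htw : ∀ p b c, Dt (w p b c) = if b && c then w p false false else 0)
    (hud : ∀ i b, Du (d i b) = if b then d i false else 0) (huw : ∀ p b c, Du (w p b c) = 0) :
    2 * Dt (signedBlockSum d w) = -Du (Du (signedBlockSum d w)) := by
  have hgraph (σ : Equiv.Perm ι) (a b c : ι) (hb : permGraph σ a b) (hc : permGraph σ a c) :
      b = c := by simp_all [permGraph]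
  have hmul (D : Derivation 𝕜 A A) (m : ℤ) (x : A) : D (m * x) = m * D x := by
    simp [D.leibniz, D.map_intCast]
  simp only [signedBlockSum, map_sum, hmul, derivation_blockProd_pair Dt htd htw (hgraph _),
    derivation_derivation_blockProd_diag Du hud huw (hgraph _),
    mul_left_comm _ (2 : A) (Finset.sum _ _), ← Finset.mul_sum, ← mul_neg]
  congr 1
  simp only [Finset.mul_sum]
  rw [Finset.sum_comm, Finset.sum_comm (s := Finset.univ), ← Finset.sum_neg_distrib]
  exact Finset.sum_congr rfl fun p hp =>
    sum_sign_mul_blockProd_two_cycle (mem_upperPairs.1 hp).ne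

end BlockHeat

section CovSum

variable {ι R S : Type*} [Fintype ι] [LinearOrder ι] [CommRing R] [CommRing S]

/-- The mixed moment of `u - X` to the power `b` and of the conjugate of `conj v - X` to the power
`c`, where `X` is a diagonal entry of an elliptic Ginibre matrix. -/
def diagWeight (u v : R) (b c : Bool) : R :=
  if b then if c then u * v + 1 else u else if c then v else 1

/-- The moment `E[X ^ b * Y ^ c]` of two mirror entries `X`, `Y` off the diagonal of a complex
Gaussian matrix whose covariances are `E[X * Y] = t` and `E[X * X] = E[Y * Y] = 0`. -/
def pairMean (t : R) (b c : Bool) : R := if b && c then t else if b || c then 0 else 1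

/-- The mixed moment `E[X ^ b₁ * Y ^ b₂ * conj (X ^ c₁ * Y ^ c₂)]` of two mirror entries `X`, `Y`
off the diagonal of an elliptic Ginibre matrix; the parameter is called `t'` in the conjugated
pair. -/
def pairWeight (t t' : R) (b₁ b₂ c₁ c₂ : Bool) : R :=
  pairMean t b₁ b₂ * pairMean t' c₁ c₂ + if b₁ = c₁ ∧ b₂ = c₂ ∧ (b₁ || b₂) then 1 else 0

variable (ι) in
/-- The sum over pairs of permutations to which `E[det (u - A) * conj (det (conj v - A))]` expands
for an elliptic Ginibre matrix `A`. -/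
def covSum (t t' u v : R) : R :=
  ∑ τ : Equiv.Perm ι, ((Equiv.Perm.sign τ : ℤ) : R) *
    signedBlockSum (fun i b => diagWeight u v b (permGraph τ i i))
      fun p b c => pairWeight t t' b c (permGraph τ p.1 p.2) (permGraph τ p.2 p.1)

lemma covSum_symm (t t' u v : R) : covSum ι t t' u v = covSum ι t' t v u := by
  have hdiag (b c : Bool) : diagWeight u v b c = diagWeight v u c b := by
    cases b <;> cases c <;> simp [diagWeight, mul_comm]
  have hpair (b₁ b₂ c₁ c₂ : Bool) :
      pairWeight t t' b₁ b₂ c₁ c₂ = pairWeight t' t c₁ c₂ b₁ b₂ := by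
    cases b₁ <;> cases b₂ <;> cases c₁ <;> cases c₂ <;> simp [pairWeight, pairMean, mul_comm]
  simp only [covSum, signedBlockSum, blockProd, hdiag, hpair, Finset.mul_sum]
  rw [Finset.sum_comm]
  simp only [mul_left_comm]

lemma map_covSum {F : Type*} [FunLike F R S] [RingHomClass F R S] (f : F) (t t' u v : R) :
    f (covSum ι t t' u v) = covSum ι (f t) (f t') (f u) (f v) := by
  simp only [covSum, signedBlockSum, blockProd, map_sum, map_mul, map_prod, map_intCast, diagWeight,
    pairWeight, pairMean, apply_ite f, map_add, map_one, map_zero]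

lemma covSum_heat [Algebra R S] (Dt Du : Derivation R S S) {t u : S} (htt : Dt t = 1)
    (htu : Dt u = 0) (hut : Du t = 0) (huu : Du u = 1) (t' v : R) :
    2 * Dt (covSum ι t (algebraMap R S t') u (algebraMap R S v)) =
      -Du (Du (covSum ι t (algebraMap R S t') u (algebraMap R S v))) := by
  have hsign (D : Derivation R S S) (m : ℤ) (x : S) : D (m * x) = m * D x := by
    simp [D.leibniz, D.map_intCast]
  simp only [covSum, map_sum, hsign, Finset.mul_sum, ← Finset.sum_neg_distrib]
  refine Finset.sum_congr rfl fun τ _ => ?_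
  rw [mul_left_comm, signedBlockSum_heat Dt Du, mul_neg]
  · rintro i (_ | _) <;> cases permGraph τ i i <;> simp [diagWeight, htu]
  · rintro p (_ | _) (_ | _) <;> cases permGraph τ p.1 p.2 <;> cases permGraph τ p.2 p.1 <;>
      simp [pairWeight, pairMean, htt]
  · rintro i (_ | _) <;> cases permGraph τ i i <;> simp [diagWeight, huu]
  · rintro p (_ | _) (_ | _) <;> cases permGraph τ p.1 p.2 <;> cases permGraph τ p.2 p.1 <;>
      simp [pairWeight, pairMean, hut]

end CovSum

section InitialValue

variable {ι R : Type*} [Fintype ι] [CommRing R]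

lemma card_perm_fixing [DecidableEq ι] (s : Finset ι) :
    Fintype.card {σ : Equiv.Perm ι // ∀ i ∈ s, σ i = i} = (Fintype.card ι - s.card).factorial := by
  have e : {σ : Equiv.Perm ι // ∀ i ∈ s, σ i = i} ≃ Equiv.Perm {i : ι // i ∉ s} :=
    (Equiv.subtypeEquivRight fun σ => by simp).trans
      (Equiv.Perm.subtypeEquivSubtypePerm fun i => i ∉ s).symm
  rw [Fintype.card_congr e, Fintype.card_perm, Fintype.card_subtype_compl]
  simp

lemma sum_perm_prod_fixed [DecidableEq ι] (y : R) :
    ∑ σ : Equiv.Perm ι, ∏ i, (if σ i = i then y + 1 else 1) =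
      ∑ k ∈ Finset.range (Fintype.card ι + 1),
        (((Fintype.card ι).choose k * (Fintype.card ι - k).factorial : ℕ) : R) * y ^ k := by
  have hexpand (σ : Equiv.Perm ι) : ∏ i, (if σ i = i then y + 1 else 1) =
      ∑ s ∈ (Finset.univ : Finset ι).powerset, if ∀ i ∈ s, σ i = i then y ^ s.card else 0 := by
    have hsplit (i : ι) : (if σ i = i then y + 1 else 1) = (if σ i = i then y else 0) + 1 := by
      split_ifs <;> simp
    simp [hsplit, Finset.prod_add, Finset.prod_ite_zero]
  have hfix (s : Finset ι) : ∑ σ : Equiv.Perm ι, (if ∀ i ∈ s, σ i = i then y ^ s.card else 0) =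
      ((Fintype.card ι - s.card).factorial : R) * y ^ s.card := by
    rw [← Finset.sum_filter, Finset.sum_const, nsmul_eq_mul, ← Fintype.card_subtype,
      card_perm_fixing]
  simp only [hexpand]
  rw [Finset.sum_comm]
  simp only [hfix]
  rw [Finset.sum_powerset_apply_card (f := fun k => ((Fintype.card ι - k).factorial : R) * y ^ k)]
  simp only [Finset.card_univ, nsmul_eq_mul, Nat.cast_mul, mul_assoc]

variable [LinearOrder ι]

lemma exists_upperPairs_permGraph_ne {σ τ : Equiv.Perm ι} (h : σ ≠ τ) : ∃ p ∈ upperPairs ι,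
    permGraph σ p.1 p.2 ≠ permGraph τ p.1 p.2 ∨ permGraph σ p.2 p.1 ≠ permGraph τ p.2 p.1 := by
  obtain ⟨i, hi⟩ : ∃ i, σ i ≠ τ i := by
    contrapose! h
    exact Equiv.ext h
  obtain ⟨j, hji, hj⟩ : ∃ j ≠ i, permGraph σ i j ≠ permGraph τ i j := by
    by_cases hσ : σ i = i
    · exact ⟨τ i, fun hτ => hi (hσ.trans hτ.symm), by simpa [permGraph] using hi⟩
    · exact ⟨σ i, hσ, by simpa [permGraph] using hi.symm⟩
  rcases lt_or_gt_of_ne hji with hlt | hlt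
  · exact ⟨(j, i), mem_upperPairs.2 hlt, Or.inr hj⟩
  · exact ⟨(i, j), mem_upperPairs.2 hlt, Or.inl hj⟩

lemma covSum_zero (u v : R) :
    covSum ι 0 0 u v = ∑ k ∈ Finset.range (Fintype.card ι + 1),
      (((Fintype.card ι).choose k * (Fintype.card ι - k).factorial : ℕ) : R) * (u * v) ^ k := by
  have hpair (b₁ b₂ c₁ c₂ : Bool) :
      pairWeight (0 : R) 0 b₁ b₂ c₁ c₂ = if b₁ = c₁ ∧ b₂ = c₂ then 1 else 0 := by
    cases b₁ <;> cases b₂ <;> cases c₁ <;> cases c₂ <;> simp [pairWeight, pairMean]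
  rw [← sum_perm_prod_fixed, covSum]
  refine Finset.sum_congr rfl fun τ _ => ?_
  rw [signedBlockSum, Finset.sum_eq_single τ, ← mul_assoc, ← Int.cast_mul, Int.units_coe_mul_self,
    Int.cast_one, one_mul]
  · simp only [blockProd, hpair, and_self, if_true, Finset.prod_const_one, mul_one]
    refine Finset.prod_congr rfl fun i _ => ?_
    by_cases hi : τ i = i <;> simp [diagWeight, permGraph, hi]
  · intro σ _ hσ
    obtain ⟨p, hp, h⟩ := exists_upperPairs_permGraph_ne hσ
    rw [blockProd, Finset.prod_eq_zero hp, mul_zero, mul_zero]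
    simp only [hpair, ite_eq_right_iff]
    tauto
  · simp

end InitialValue

section HermiteSum

variable {ι R : Type*} [Fintype ι] [LinearOrder ι] [CommRing R]

/-- The truncated Mehler kernel of the monic Hermite polynomials. -/
def hermiteSum (n : ℕ) (t t' u v : R) : R :=
  ∑ k ∈ Finset.range (n + 1), ((n.choose k * (n - k).factorial : ℕ) : R) *
    (hermiteVar t u k * hermiteVar t' v k)

variable [IsDomain R] [CharZero R]

lemma covSum_eq_sum_hermiteVar {t' v : R} {n : ℕ} {c : ℕ → R}
    (h₀ : ∀ u, covSum ι 0 t' u v = ∑ k ∈ Finset.range n, c k * u ^ k) (t u : R) :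
    covSum ι t t' u v = ∑ k ∈ Finset.range n, c k * hermiteVar t u k := by
  open MvPolynomial in
  have : Infinite R := CharZero.infinite R
  have hpoly : (covSum ι (X 0) (C t') (X 1) (C v) : MvPolynomial (Fin 2) R) =
      ∑ k ∈ Finset.range n, C (c k) * hermiteVar (X 0) (X 1) k := by
    apply eq_sum_hermiteVar_of_heat
    · exact covSum_heat (pderiv 0) (pderiv 1) (pderiv_X_self 0) (pderiv_X_of_ne (by decide))
        (pderiv_X_of_ne (by decide)) (pderiv_X_self 1) t' v
    · refine MvPolynomial.funext fun x => ?_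
      simp [map_covSum, algebraMap_eq, h₀]
  simpa [map_covSum, map_hermiteVar] using congrArg (eval ![t, u]) hpoly

theorem covSum_eq_hermiteSum (t t' u v : R) :
    covSum ι t t' u v = hermiteSum (Fintype.card ι) t t' u v := by
  have hmono (v u : R) : covSum ι 0 0 v u = ∑ k ∈ Finset.range (Fintype.card ι + 1),
      ((Fintype.card ι).choose k * (Fintype.card ι - k).factorial : ℕ) * u ^ k * v ^ k := by
    rw [covSum_zero]
    exact Finset.sum_congr rfl fun k _ => by ring
  have hinit (u : R) : covSum ι 0 t' u v = ∑ k ∈ Finset.range (Fintype.card ι + 1),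
      ((Fintype.card ι).choose k * (Fintype.card ι - k).factorial : ℕ) * hermiteVar t' v k *
        u ^ k := by
    rw [covSum_symm, covSum_eq_sum_hermiteVar (hmono · u)]
    exact Finset.sum_congr rfl fun k _ => by ring
  rw [covSum_eq_sum_hermiteVar hinit, hermiteSum]
  exact Finset.sum_congr rfl fun k _ => by ring

end HermiteSum

section AllMoments

open scoped NNReal ENNReal

/-- All absolute moments of the random variable `f` are finite. -/
def AllMoments {Ω : Type*} [MeasurableSpace Ω] (f : Ω → ℂ) (μ : Measure Ω) : Prop :=
  ∀ p : ℝ≥0, MemLp f p μ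

namespace AllMoments

variable {Ω Ω' : Type*} [MeasurableSpace Ω] [MeasurableSpace Ω'] {μ : Measure Ω} {f g : Ω → ℂ}

lemma integrable (hf : AllMoments f μ) : Integrable f μ :=
  memLp_one_iff_integrable.1 (by simpa using hf 1)

lemma const [IsFiniteMeasure μ] (c : ℂ) : AllMoments (fun _ => c) μ := fun _ => memLp_const c

lemma add (hf : AllMoments f μ) (hg : AllMoments g μ) : AllMoments (fun x => f x + g x) μ :=
  fun p => (hf p).add (hg p)

lemma sub (hf : AllMoments f μ) (hg : AllMoments g μ) : AllMoments (fun x => f x - g x) μ :=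
  fun p => (hf p).sub (hg p)

lemma mul (hf : AllMoments f μ) (hg : AllMoments g μ) : AllMoments (fun x => f x * g x) μ := by
  intro p
  have hp : ENNReal.HolderTriple ((2 * p : ℝ≥0) : ℝ≥0∞) ((2 * p : ℝ≥0) : ℝ≥0∞) (p : ℝ≥0∞) := by
    constructor
    rcases eq_or_ne p 0 with rfl | hp
    · simp
    · rw [← ENNReal.coe_inv (by positivity), ← ENNReal.coe_inv hp, ← ENNReal.coe_add,
        ENNReal.coe_inj]
      field_simp
      norm_num
  exact (hg (2 * p)).mul (hf (2 * p))

lemma const_mul [IsFiniteMeasure μ] (c : ℂ) (hf : AllMoments f μ) :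
    AllMoments (fun x => c * f x) μ := (const c).mul hf

lemma conj (hf : AllMoments f μ) : AllMoments (fun x => (starRingEnd ℂ) (f x)) μ := fun p =>
  (hf p).of_le (Complex.continuous_conj.comp_aestronglyMeasurable (hf p).1) (by simp)

lemma pow [IsFiniteMeasure μ] (hf : AllMoments f μ) (k : ℕ) : AllMoments (fun x => f x ^ k) μ := by
  induction k with
  | zero => simpa using const 1
  | succ k ih => simpa only [pow_succ] using ih.mul hf

lemma finset_sum {α : Type*} (s : Finset α) {F : α → Ω → ℂ}
    (h : ∀ a ∈ s, AllMoments (F a) μ) : AllMoments (fun x => ∑ a ∈ s, F a x) μ :=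
  fun p => memLp_finsetSum s fun a ha => h a ha p

lemma finset_prod [IsFiniteMeasure μ] {α : Type*} (s : Finset α) {F : α → Ω → ℂ}
    (h : ∀ a ∈ s, AllMoments (F a) μ) : AllMoments (fun x => ∏ a ∈ s, F a x) μ := by
  classical
  induction s using Finset.induction_on with
  | empty => simpa using const 1
  | insert a s ha ih =>
    simp only [Finset.prod_insert ha]
    exact (h a (by simp)).mul (ih fun b hb => h b (by simp [hb]))

lemma comp_measurePreserving {ν : Measure Ω'} {φ : Ω' → Ω} (hf : AllMoments f μ)
    (hφ : MeasurePreserving φ ν μ) : AllMoments (fun x => f (φ x)) ν :=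
  fun p => (hf p).comp_measurePreserving hφ

lemma quadratic [IsFiniteMeasure μ] (hf : AllMoments f μ) (p₀ p₁ p₂ : ℂ) :
    AllMoments (fun x => p₀ + p₁ * f x + p₂ * f x ^ 2) μ :=
  ((const p₀).add (hf.const_mul p₁)).add ((hf.pow 2).const_mul p₂)

end AllMoments

end AllMoments

section GaussianMoments

lemma allMoments_ofReal_gaussianReal : AllMoments (fun x : ℝ => (x : ℂ)) (gaussianReal 0 1) :=
  fun p => (memLp_id_gaussianReal p).ofReal

lemma iteratedDeriv_exp_sq_div_two_add_two (k : ℕ) (x : ℝ) :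
    iteratedDeriv (k + 2) (fun s : ℝ => Real.exp (s ^ 2 / 2)) x =
      x * iteratedDeriv (k + 1) (fun s : ℝ => Real.exp (s ^ 2 / 2)) x +
        (k + 1) * iteratedDeriv k (fun s : ℝ => Real.exp (s ^ 2 / 2)) x := by
  set f : ℝ → ℝ := fun s => Real.exp (s ^ 2 / 2)
  have hf : ContDiff ℝ ⊤ f := by fun_prop
  have hderiv : deriv f = fun s => s * f s := by
    ext s
    simpa [f, mul_comm] using (((hasDerivAt_pow 2 s).div_const 2).exp).deriv
  have hiter (k : ℕ) (x : ℝ) : HasDerivAt (iteratedDeriv k f) (iteratedDeriv (k + 1) f x) x := by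
    rw [iteratedDeriv_succ]
    exact (hf.differentiable_iteratedDeriv k (by simp) x).hasDerivAt
  have hsucc : ∀ k x, HasDerivAt (iteratedDeriv (k + 1) f)
      (x * iteratedDeriv (k + 1) f x + (k + 1) * iteratedDeriv k f x) x := by
    intro k
    induction k with
    | zero =>
      intro x
      simpa [hderiv, add_comm] using (hasDerivAt_id' x).fun_mul (hiter 0 x)
    | succ k ih =>
      intro x
      have heq : iteratedDeriv (k + 1 + 1) f =
          fun y => y * iteratedDeriv (k + 1) f y + (k + 1) * iteratedDeriv k f y := by
        rw [iteratedDeriv_succ]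
        exact funext fun y => (ih y).deriv
      have h := ((hasDerivAt_id x).mul (hiter (k + 1) x)).add
        ((hiter k x).const_mul ((k : ℝ) + 1))
      rw [heq]
      refine h.congr_deriv ?_
      simp only [id, heq]
      push_cast
      ring
  rw [iteratedDeriv_succ]
  exact (hsucc k x).deriv

lemma integral_pow_add_two_gaussianReal (k : ℕ) :
    ∫ x : ℝ, x ^ (k + 2) ∂gaussianReal 0 1 = (k + 1) * ∫ x : ℝ, x ^ k ∂gaussianReal 0 1 := by
  have hmgf : mgf id (gaussianReal 0 1) = fun s => Real.exp (s ^ 2 / 2) := by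
    rw [mgf_id_gaussianReal]; ext s; simp
  have hmoment (k : ℕ) : ∫ x : ℝ, x ^ k ∂gaussianReal 0 1 =
      iteratedDeriv k (fun s : ℝ => Real.exp (s ^ 2 / 2)) 0 := by
    rw [← hmgf, iteratedDeriv_mgf_zero (by simp [integrableExpSet_id_gaussianReal])]; simp
  simp [hmoment, iteratedDeriv_exp_sq_div_two_add_two]

lemma integral_quadratic_mul_quadratic_gaussianReal (p₀ p₁ p₂ q₀ q₁ q₂ : ℂ) :
    ∫ x : ℝ, (p₀ + p₁ * x + p₂ * x ^ 2) * (q₀ + q₁ * x + q₂ * x ^ 2) ∂gaussianReal 0 1 =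
      (p₀ + p₂) * (q₀ + q₂) + p₁ * q₁ + 2 * p₂ * q₂ := by
  have hmoment (k : ℕ) : ∫ x : ℝ, (x : ℂ) ^ k ∂gaussianReal 0 1 =
      ((∫ x : ℝ, x ^ k ∂gaussianReal 0 1 : ℝ) : ℂ) := by
    simp only [← Complex.ofReal_pow, integral_complex_ofReal]
  have hexpand (x : ℝ) : (p₀ + p₁ * x + p₂ * x ^ 2) * (q₀ + q₁ * x + q₂ * x ^ 2) =
      ∑ k : Fin 5, ![p₀ * q₀, p₀ * q₁ + p₁ * q₀, p₀ * q₂ + p₁ * q₁ + p₂ * q₀,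
        p₁ * q₂ + p₂ * q₁, p₂ * q₂] k * (x : ℂ) ^ (k : ℕ) := by
    simp [Fin.sum_univ_five]
    ring
  simp only [hexpand]
  rw [integral_finsetSum _ fun (k : Fin 5) _ =>
    (allMoments_ofReal_gaussianReal.pow k).integrable.const_mul _]
  simp [integral_const_mul, Fin.sum_univ_five, hmoment, integral_pow_add_two_gaussianReal 0,
    integral_pow_add_two_gaussianReal 1, integral_pow_add_two_gaussianReal 2]
  ring

end GaussianMoments

section EllipticGaussian

/-- The elliptic complex Gaussian variable `√((1+t)/2) x + i √((1-t)/2) y`; all entries of the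
elliptic Ginibre matrix are combinations of independent copies of it. -/
def ellipticGaussian (t : ℝ) (x : ℝ × ℝ) : ℂ :=
  (√((1 + t) / 2) : ℝ) * x.1 + Complex.I * (√((1 - t) / 2) : ℝ) * x.2

lemma measurable_ellipticGaussian (t : ℝ) : Measurable (ellipticGaussian t) := by
  unfold ellipticGaussian; fun_prop

/-- The law of the elliptic complex Gaussian variable: centred, with `E[|Z|²] = 1` and
`E[Z²] = t`. -/
def ellipticLaw (t : ℝ) : Measure ℂ :=
  ((gaussianReal 0 1).prod (gaussianReal 0 1)).map (ellipticGaussian t)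

instance isProbabilityMeasure_ellipticLaw (t : ℝ) : IsProbabilityMeasure (ellipticLaw t) :=
  Measure.isProbabilityMeasure_map (measurable_ellipticGaussian t).aemeasurable

lemma allMoments_ellipticLaw (t : ℝ) : AllMoments (fun z => z) (ellipticLaw t) := by
  have hfst := allMoments_ofReal_gaussianReal.comp_measurePreserving
    (measurePreserving_fst (μ := gaussianReal 0 1) (ν := gaussianReal 0 1))
  have hsnd := allMoments_ofReal_gaussianReal.comp_measurePreserving
    (measurePreserving_snd (μ := gaussianReal 0 1) (ν := gaussianReal 0 1))
  have h := (hfst.const_mul (√((1 + t) / 2) : ℝ)).add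
    (hsnd.const_mul (Complex.I * (√((1 - t) / 2) : ℝ)))
  exact fun p => (memLp_map_measure_iff aestronglyMeasurable_id
    (measurable_ellipticGaussian t).aemeasurable).2 (h p)

lemma integral_quadratic_mul_quadratic_ellipticGaussian (t : ℝ) (p₀ p₁ p₂ q₀ q₁ q₂ : ℂ)
    (x : ℝ) {α β : ℂ} (hα : α = (√((1 + t) / 2) : ℝ)) (hβ : β = (√((1 - t) / 2) : ℝ)) :
    ∫ y, (p₀ + p₁ * ellipticGaussian t (x, y) + p₂ * ellipticGaussian t (x, y) ^ 2) *
        (q₀ + q₁ * (starRingEnd ℂ) (ellipticGaussian t (x, y)) +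
          q₂ * (starRingEnd ℂ) (ellipticGaussian t (x, y)) ^ 2) ∂gaussianReal 0 1 =
      (p₀ - β ^ 2 * p₂ + α * p₁ * x + α ^ 2 * p₂ * x ^ 2) *
          (q₀ - β ^ 2 * q₂ + α * q₁ * x + α ^ 2 * q₂ * x ^ 2) +
        (β * p₁ + 2 * α * β * p₂ * x + 0 * x ^ 2) * (β * q₁ + 2 * α * β * q₂ * x + 0 * x ^ 2) +
        2 * β ^ 4 * p₂ * q₂ := by
  have h := integral_quadratic_mul_quadratic_gaussianReal
    (p₀ + α * p₁ * x + α ^ 2 * p₂ * x ^ 2) (Complex.I * (β * p₁ + 2 * α * β * p₂ * x))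
    (-β ^ 2 * p₂) (q₀ + α * q₁ * x + α ^ 2 * q₂ * x ^ 2)
    (-Complex.I * (β * q₁ + 2 * α * β * q₂ * x)) (-β ^ 2 * q₂)
  convert! h using 1
  · congr 1 with y
    simp only [ellipticGaussian, map_add, map_mul, Complex.conj_ofReal, Complex.conj_I]
    rw [← hα, ← hβ]
    congr 1 <;> ring_nf <;> rw [Complex.I_sq] <;> ring
  · ring_nf
    rw [Complex.I_sq]
    ring

lemma integral_quadratic_mul_quadratic_ellipticLaw {t : ℝ} (ht : |t| ≤ 1)
    (p₀ p₁ p₂ q₀ q₁ q₂ : ℂ) :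
    ∫ z, (p₀ + p₁ * z + p₂ * z ^ 2) *
        (q₀ + q₁ * (starRingEnd ℂ) z + q₂ * (starRingEnd ℂ) z ^ 2) ∂ellipticLaw t =
      (p₀ + t * p₂) * (q₀ + t * q₂) + p₁ * q₁ + 2 * p₂ * q₂ := by
  set α : ℂ := ((√((1 + t) / 2) : ℝ) : ℂ) with hα
  set β : ℂ := ((√((1 - t) / 2) : ℝ) : ℂ) with hβ
  have hα2 : α ^ 2 = (1 + t) / 2 := by
    rw [hα, ← Complex.ofReal_pow, Real.sq_sqrt (by linarith [neg_abs_le t])]; push_cast; rfl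
  have hβ2 : β ^ 2 = (1 - t) / 2 := by
    rw [hβ, ← Complex.ofReal_pow, Real.sq_sqrt (by linarith [le_abs_self t])]; push_cast; rfl
  have hint : Integrable (fun z => (p₀ + p₁ * z + p₂ * z ^ 2) *
      (q₀ + q₁ * (starRingEnd ℂ) z + q₂ * (starRingEnd ℂ) z ^ 2)) (ellipticLaw t) :=
    (((allMoments_ellipticLaw t).quadratic _ _ _).mul
      ((allMoments_ellipticLaw t).conj.quadratic _ _ _)).integrable
  have hreal (a₀ a₁ a₂ b₀ b₁ b₂ : ℂ) : Integrable (fun x : ℝ =>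
      (a₀ + a₁ * x + a₂ * x ^ 2) * (b₀ + b₁ * x + b₂ * x ^ 2)) (gaussianReal 0 1) :=
    ((allMoments_ofReal_gaussianReal.quadratic _ _ _).mul
      (allMoments_ofReal_gaussianReal.quadratic _ _ _)).integrable
  rw [ellipticLaw, integral_map (measurable_ellipticGaussian t).aemeasurable
    hint.aestronglyMeasurable]
  refine (integral_prod _ (hint.comp_measurable (measurable_ellipticGaussian t))).trans ?_
  simp only [Function.comp_apply,
    integral_quadratic_mul_quadratic_ellipticGaussian t _ _ _ _ _ _ _ hα hβ]
  rw [integral_add ((hreal ..).fun_add (hreal ..)) (integrable_const _), integral_add (hreal ..)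
    (hreal ..), integral_quadratic_mul_quadratic_gaussianReal,
    integral_quadratic_mul_quadratic_gaussianReal]
  simp only [integral_const, probReal_univ, one_smul]
  have hβ4 : β ^ 4 = ((1 - t) / 2) ^ 2 := by rw [← hβ2]; ring
  ring_nf
  simp only [hβ4, hα2, hβ2, show α ^ 4 = ((1 + t) / 2) ^ 2 by rw [← hα2]; ring]
  ring

/-- The entry above the diagonal of a block of an elliptic Ginibre matrix, from two independent
elliptic Gaussian variables. -/
def upperEntry (z w : ℂ) : ℂ := (z + Complex.I * w) / (√2 : ℝ)

/-- The mirror entry below the diagonal of a block of an elliptic Ginibre matrix, from the same two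
elliptic Gaussian variables as `upperEntry`. -/
def lowerEntry (z w : ℂ) : ℂ := (z - Complex.I * w) / (√2 : ℝ)

lemma integral_pair_ellipticLaw {t : ℝ} (ht : |t| ≤ 1) (p₀ p₁ p₂ p₃ q₀ q₁ q₂ q₃ : ℂ) :
    ∫ z, ∫ w, (p₀ + p₁ * upperEntry z w + p₂ * lowerEntry z w +
          p₃ * (upperEntry z w * lowerEntry z w)) *
        (q₀ + q₁ * (starRingEnd ℂ) (upperEntry z w) + q₂ * (starRingEnd ℂ) (lowerEntry z w) +
          q₃ * (starRingEnd ℂ) (upperEntry z w * lowerEntry z w)) ∂ellipticLaw t ∂ellipticLaw t =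
      (p₀ + t * p₃) * (q₀ + t * q₃) + p₁ * q₁ + p₂ * q₂ + p₃ * q₃ := by
  set s : ℂ := ((√2 : ℝ) : ℂ)⁻¹ with hs
  have hs2 : s ^ 2 = 1 / 2 := by
    rw [hs, inv_pow, ← Complex.ofReal_pow, Real.sq_sqrt (by norm_num)]; norm_num
  have hs_conj : (starRingEnd ℂ) s = s := by rw [hs, map_inv₀, Complex.conj_ofReal]
  have hinner (z : ℂ) : ∫ w, (p₀ + p₁ * upperEntry z w + p₂ * lowerEntry z w +
          p₃ * (upperEntry z w * lowerEntry z w)) *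
        (q₀ + q₁ * (starRingEnd ℂ) (upperEntry z w) + q₂ * (starRingEnd ℂ) (lowerEntry z w) +
          q₃ * (starRingEnd ℂ) (upperEntry z w * lowerEntry z w)) ∂ellipticLaw t =
      (p₀ + t * p₃ / 2 + s * (p₁ + p₂) * z + p₃ / 2 * z ^ 2) *
        (q₀ + t * q₃ / 2 + s * (q₁ + q₂) * (starRingEnd ℂ) z + q₃ / 2 * (starRingEnd ℂ) z ^ 2) +
        ((p₁ - p₂) * (q₁ - q₂) / 2 + p₃ * q₃ / 2) := by
    have h := integral_quadratic_mul_quadratic_ellipticLaw ht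
      (p₀ + s * (p₁ + p₂) * z + p₃ / 2 * z ^ 2) (Complex.I * s * (p₁ - p₂)) (p₃ / 2)
      (q₀ + s * (q₁ + q₂) * (starRingEnd ℂ) z + q₃ / 2 * (starRingEnd ℂ) z ^ 2)
      (-Complex.I * s * (q₁ - q₂)) (q₃ / 2)
    convert! h using 1
    · congr 1 with w
      simp only [upperEntry, lowerEntry, div_eq_mul_inv _ ((√2 : ℝ) : ℂ), ← hs, map_add, map_sub,
        map_mul, Complex.conj_I, hs_conj]
      congr 1 <;> ring_nf <;> rw [Complex.I_sq, hs2] <;> ring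
    · ring_nf
      rw [Complex.I_sq, hs2]
      ring
  have hint := ((allMoments_ellipticLaw t).quadratic (p₀ + t * p₃ / 2) (s * (p₁ + p₂))
    (p₃ / 2)).mul ((allMoments_ellipticLaw t).conj.quadratic (q₀ + t * q₃ / 2) (s * (q₁ + q₂))
    (q₃ / 2))
  simp only [hinner]
  rw [integral_add hint.integrable (integrable_const _),
    integral_quadratic_mul_quadratic_ellipticLaw ht]
  simp only [integral_const, probReal_univ, one_smul]
  linear_combination ((p₁ + p₂) * (q₁ + q₂)) * hs2

end EllipticGaussian

section Independence

variable {Ω ι κ 𝓧 : Type*} [MeasurableSpace Ω] [MeasurableSpace 𝓧]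

lemma integral_comp_of_measurePreserving {μ : Measure Ω} {ν : Measure 𝓧} {φ : Ω → 𝓧}
    (hφ : MeasurePreserving φ μ ν) {f : 𝓧 → ℂ} (hf : Measurable f) :
    ∫ ω, f (φ ω) ∂μ = ∫ x, f x ∂ν := by
  rw [← hφ.map_eq, integral_map hφ.measurable.aemeasurable hf.aestronglyMeasurable]

lemma iIndepFun_fibers {P : Measure Ω} [IsProbabilityMeasure P] {X : ι → Ω → 𝓧}
    (mX : ∀ i, Measurable (X i)) (h : iIndepFun X P) (f : ι → κ) :
    iIndepFun (fun k ω (x : {i // f i = k}) => X x ω) P := by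
  have (i : ι) : IsProbabilityMeasure (P.map (X i)) :=
    Measure.isProbabilityMeasure_map (mX i).aemeasurable
  have hfiber (k : κ) : P.map (fun ω (x : {i // f i = k}) => X x ω) =
      Measure.infinitePi fun x : {i // f i = k} => P.map (X x) :=
    (iIndepFun_iff_map_fun_eq_infinitePi_map (fun _ => mX _)).1
      (h.precomp Subtype.val_injective)
  have hsigma := (iIndepFun_iff_map_fun_eq_infinitePi_map (fun _ => mX _)).1
    (h.precomp (g := fun s : (k : κ) × {i // f i = k} => (s.2 : ι))
      (Equiv.sigmaFiberEquiv f).injective)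
  rw [iIndepFun_iff_map_fun_eq_infinitePi_map (by fun_prop)]
  simp only [hfiber]
  rw [← Measure.infinitePi_map_piCurry fun (k : κ) (x : {i // f i = k}) => P.map (X x), ← hsigma,
    Measure.map_map (by fun_prop) (by fun_prop)]
  rfl

variable [Fintype ι]

variable (ι) in
/-- The law of an `ι × ι` array of independent entries with law `ρ`. -/
def arrayLaw (ρ : Measure 𝓧) : Measure (ι → ι → 𝓧) := Measure.pi fun _ => Measure.pi fun _ => ρ

variable {ρ : Measure 𝓧} [IsProbabilityMeasure ρ]

instance isProbabilityMeasure_arrayLaw : IsProbabilityMeasure (arrayLaw ι ρ) := by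
  unfold arrayLaw; infer_instance

lemma iIndepFun_arrayLaw :
    iIndepFun (fun (p : ι × ι) (ω : ι → ι → 𝓧) => ω p.1 p.2) (arrayLaw ι ρ) := by
  have h := iIndepFun_uncurry_infinitePi' (ι := ι) (κ := ι) (X := fun _ _ x => x)
    (fun _ _ => ρ) (fun _ _ => measurable_id)
  simpa only [arrayLaw, Measure.infinitePi_eq_pi] using h

lemma measurePreserving_eval_arrayLaw (i j : ι) :
    MeasurePreserving (fun ω : ι → ι → 𝓧 => ω i j) (arrayLaw ι ρ) ρ :=
  (measurePreserving_eval (fun _ : ι => ρ) j).comp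
    (measurePreserving_eval (fun _ : ι => Measure.pi fun _ : ι => ρ) i)

lemma measurePreserving_eval_pair_arrayLaw {i j : ι} (hij : i ≠ j) :
    MeasurePreserving (fun ω : ι → ι → 𝓧 => (ω i j, ω j i)) (arrayLaw ι ρ) (ρ.prod ρ) := by
  have hrows : MeasurePreserving (fun ω : ι → ι → 𝓧 => (ω i, ω j)) (arrayLaw ι ρ)
      ((Measure.pi fun _ : ι => ρ).prod (Measure.pi fun _ : ι => ρ)) := by
    refine ⟨by fun_prop, ?_⟩
    have h := Measure.infinitePi_map_eval_prod
      (P := fun _ : ι => Measure.pi fun _ : ι => ρ) hij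
    rwa [Measure.infinitePi_eq_pi] at h
  exact ((measurePreserving_eval (fun _ : ι => ρ) j).prod
    (measurePreserving_eval (fun _ : ι => ρ) i)).comp hrows

lemma measurePreserving_map_arrayLaw {𝓨 : Type*} [MeasurableSpace 𝓨] {φ : 𝓧 → 𝓨}
    (hφ : Measurable φ) : MeasurePreserving (fun ω i j => φ (ω i j)) (arrayLaw ι ρ)
      (arrayLaw ι (ρ.map φ)) := by
  have : IsProbabilityMeasure (ρ.map φ) := Measure.isProbabilityMeasure_map hφ.aemeasurable
  exact measurePreserving_pi _ _ fun _ => measurePreserving_pi _ _ fun _ => ⟨hφ, rfl⟩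

lemma measurePreserving_unzip_arrayLaw {𝓨 : Type*} [MeasurableSpace 𝓨] (ν : Measure 𝓨)
    [IsProbabilityMeasure ν] :
    MeasurePreserving (fun (ω : ι → ι → 𝓧 × 𝓨) => (fun i j => (ω i j).1, fun i j => (ω i j).2))
      (arrayLaw ι (ρ.prod ν)) ((arrayLaw ι ρ).prod (arrayLaw ι ν)) :=
  (measurePreserving_arrowProdEquivProdArrow (ι → 𝓧) (ι → 𝓨) ι
    (fun _ => Measure.pi fun _ : ι => ρ) (fun _ => Measure.pi fun _ : ι => ν)).comp
  (measurePreserving_pi (fun _ => Measure.pi fun _ : ι => ρ.prod ν)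
    (fun _ => (Measure.pi fun _ : ι => ρ).prod (Measure.pi fun _ : ι => ν)) fun _ =>
      measurePreserving_arrowProdEquivProdArrow 𝓧 𝓨 ι (fun _ => ρ) (fun _ => ν))

variable [LinearOrder ι]

/-- Position `p` of the array contributes `G p`, which reads the entries at `p` and at `p.swap`,
so `min` and `max` of the indices label the independent blocks. -/
lemma integral_prod_mirror_arrayLaw {G : ι × ι → 𝓧 × 𝓧 → ℂ} (hG : ∀ p, Measurable (G p))
    (hlow : ∀ p, p.2 < p.1 → G p = fun _ => 1) :
    ∫ ω, ∏ p : ι × ι, G p (ω p.1 p.2, ω p.2 p.1) ∂arrayLaw ι ρ =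
      ∏ p : ι × ι, ∫ ω, G p (ω p.1 p.2, ω p.2 p.1) ∂arrayLaw ι ρ := by
  let f : ι × ι → ι × ι := fun p => (min p.1 p.2, max p.1 p.2)
  have hself (p : ι × ι) (hp : p.1 ≤ p.2) : f p = p := by simp [f, hp]
  have hswap (p : ι × ι) (hp : p.1 ≤ p.2) : f p.swap = p := by simp [f, hp]
  let F : ∀ p : ι × ι, ({q // f q = p} → 𝓧) → ℂ := fun p x =>
    if hp : p.1 ≤ p.2 then G p (x ⟨p, hself p hp⟩, x ⟨p.swap, hswap p hp⟩) else 1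
  have hF (p : ι × ι) : Measurable (F p) := by
    by_cases hp : p.1 ≤ p.2
    · simp only [F, hp, dite_true]
      exact (hG p).comp (by fun_prop)
    · simp only [F, hp, dite_false]
      exact measurable_const
  have hFG (p : ι × ι) (ω : ι → ι → 𝓧) :
      G p (ω p.1 p.2, ω p.2 p.1) = F p (fun x => ω x.1.1 x.1.2) := by
    by_cases hp : p.1 ≤ p.2
    · simp only [F, hp, dite_true, Prod.fst_swap, Prod.snd_swap]
    · simp only [F, hp, dite_false, hlow p (not_le.1 hp)]
  simp only [hFG]
  exact (iIndepFun_fibers (fun p => by fun_prop) iIndepFun_arrayLaw f).integral_fun_prod_comp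
    (fun p => Measurable.aemeasurable (by fun_prop)) (fun p => (hF p).aestronglyMeasurable)

lemma integral_prod_blocks_arrayLaw {f : ι → 𝓧 → ℂ} {F : ι × ι → 𝓧 × 𝓧 → ℂ}
    (hf : ∀ i, Measurable (f i)) (hF : ∀ p, Measurable (F p)) :
    ∫ ω, (∏ i, f i (ω i i)) * ∏ p ∈ upperPairs ι, F p (ω p.1 p.2, ω p.2 p.1) ∂arrayLaw ι ρ =
      (∏ i, ∫ x, f i x ∂ρ) * ∏ p ∈ upperPairs ι, ∫ x, F p x ∂ρ.prod ρ := by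
  let G : ι × ι → 𝓧 × 𝓧 → ℂ := fun p x =>
    if p.1 = p.2 then f p.1 x.1 else if p.1 < p.2 then F p x else 1
  have hdiag (i : ι) (x : 𝓧 × 𝓧) : G (i, i) x = f i x.1 := by simp [G]
  have hupper {p : ι × ι} (hp : p.1 < p.2) : G p = F p := by ext x; simp [G, hp, hp.ne]
  have hlower {p : ι × ι} (hp : p.2 < p.1) : G p = fun _ => 1 := by
    ext x; simp [G, hp.ne', hp.not_gt]
  have hG (p : ι × ι) : Measurable (G p) := by
    unfold G
    split_ifs <;> fun_prop
  have hpair {p : ι × ι} (hp : p ∈ upperPairs ι) : p.1 < p.2 := mem_upperPairs.1 hp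
  have h := integral_prod_mirror_arrayLaw (ρ := ρ) hG fun p hp => hlower hp
  simp only [Fintype.prod_prod_type] at h
  rw [prod_eq_prod_diag_mul_prod_upperPairs fun i j => ∫ ω, G (i, j) (ω i j, ω j i) ∂arrayLaw ι ρ]
    at h
  simp only [fun ω : ι → ι → 𝓧 =>
    prod_eq_prod_diag_mul_prod_upperPairs fun i j => G (i, j) (ω i j, ω j i), hdiag] at h
  convert! h using 1
  · refine integral_congr_ae (.of_forall fun ω => ?_)
    beta_reduce
    congr 1
    refine Finset.prod_congr rfl fun p hp => ?_
    rw [hupper (hpair hp), hlower (p := (p.2, p.1)) (hpair hp), mul_one]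
  · congr 1
    · exact Finset.prod_congr rfl fun i _ =>
        (integral_comp_of_measurePreserving (measurePreserving_eval_arrayLaw i i) (hf i)).symm
    · refine Finset.prod_congr rfl fun p hp => ?_
      rw [hupper (hpair hp), hlower (p := (p.2, p.1)) (hpair hp), integral_const, probReal_univ,
        one_smul, mul_one]
      exact (integral_comp_of_measurePreserving
        (measurePreserving_eval_pair_arrayLaw (hpair hp).ne) (hF p)).symm

end Independence

section MatrixLaw

lemma measurable_matrix_apply {n : ℕ} (i j : Fin n) :
    Measurable fun A : Matrix (Fin n) (Fin n) ℂ => A i j :=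
  (measurable_pi_apply (X := fun _ : Fin n => ℂ) j).comp
    (measurable_pi_apply (X := fun _ : Fin n => Fin n → ℂ) i)

lemma measurable_det_smul_one_sub_smul {Ω : Type*} [MeasurableSpace Ω] {n : ℕ} {c w : Ω → ℂ}
    {A : Ω → Matrix (Fin n) (Fin n) ℂ} (hc : Measurable c) (hw : Measurable w)
    (hA : Measurable A) : Measurable fun x => (c x • 1 - w x • A x).det := by
  simp only [Matrix.det_apply', Matrix.sub_apply, Matrix.smul_apply, smul_eq_mul]
  exact Finset.measurable_sum _ fun σ _ => .const_mul (Finset.measurable_prod _ fun i _ =>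
    (hc.mul_const _).sub (hw.mul ((measurable_matrix_apply _ _).comp hA))) _

/-- The matrix with diagonal `g i i` whose mirror entries `(i, j)`, `(j, i)` with `i < j` are built
from `g i j` and `g j i`; for real arrays this is `hermitianOfReal`. -/
def matrixOfArray (n : ℕ) (g : Fin n → Fin n → ℂ) : Matrix (Fin n) (Fin n) ℂ :=
  Matrix.of fun i j =>
    if i < j then upperEntry (g i j) (g j i) else if j < i then lowerEntry (g j i) (g i j)
    else g i i

lemma measurable_matrixOfArray (n : ℕ) : Measurable (matrixOfArray n) := by
  refine measurable_pi_lambda _ fun i => measurable_pi_lambda _ fun j => ?_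
  simp only [matrixOfArray, upperEntry, lowerEntry, Matrix.of_apply]
  split_ifs <;> fun_prop

lemma ellipticCombination_hermitianOfReal (n : ℕ) (t : ℝ) (x y : Fin n → Fin n → ℝ) :
    ellipticCombination n t (hermitianOfReal n x, hermitianOfReal n y) =
      matrixOfArray n fun i j => ellipticGaussian t (x i j, y i j) := by
  ext i j
  simp only [ellipticCombination, hermitianOfReal, matrixOfArray, ellipticGaussian, upperEntry,
    lowerEntry, Matrix.add_apply, Matrix.smul_apply, Matrix.of_apply, smul_eq_mul]
  split_ifs <;> ring

lemma egeLaw_eq_map_arrayLaw (n : ℕ) (t : ℝ) :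
    egeLaw n t = (arrayLaw (Fin n) (ellipticLaw t)).map (matrixOfArray n) := by
  have hherm := measurable_hermitianOfReal n
  have hgue : (gueLaw n).prod (gueLaw n) =
      ((arrayLaw (Fin n) (gaussianReal 0 1)).prod (arrayLaw (Fin n) (gaussianReal 0 1))).map
        (Prod.map (hermitianOfReal n) (hermitianOfReal n)) :=
    Measure.map_prod_map _ _ hherm hherm
  have hunzip := measurePreserving_unzip_arrayLaw (ι := Fin n) (ρ := gaussianReal 0 1)
    (gaussianReal 0 1)
  have helliptic := measurePreserving_map_arrayLaw (ι := Fin n)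
    (ρ := (gaussianReal 0 1).prod (gaussianReal 0 1)) (measurable_ellipticGaussian t)
  rw [egeLaw, hgue, ← hunzip.map_eq, ellipticLaw, ← helliptic.map_eq,
    Measure.map_map (hherm.prodMap hherm) hunzip.measurable,
    Measure.map_map (measurable_ellipticCombination n t)
      ((hherm.prodMap hherm).comp hunzip.measurable),
    Measure.map_map (measurable_matrixOfArray n) helliptic.measurable]
  congr 1
  ext1 ω
  exact ellipticCombination_hermitianOfReal n t _ _

lemma allMoments_entry_arrayLaw {ι : Type*} [Fintype ι] (t : ℝ) (i j : ι) :
    AllMoments (fun ω => ω i j) (arrayLaw ι (ellipticLaw t)) :=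
  (allMoments_ellipticLaw t).comp_measurePreserving (measurePreserving_eval_arrayLaw i j)

lemma allMoments_upperEntry {Ω : Type*} [MeasurableSpace Ω] {μ : Measure Ω} [IsFiniteMeasure μ]
    {f g : Ω → ℂ} (hf : AllMoments f μ) (hg : AllMoments g μ) :
    AllMoments (fun x => upperEntry (f x) (g x)) μ := by
  simpa only [upperEntry, div_eq_inv_mul] using
    (hf.add (hg.const_mul Complex.I)).const_mul (((√2 : ℝ) : ℂ)⁻¹)

lemma allMoments_lowerEntry {Ω : Type*} [MeasurableSpace Ω] {μ : Measure Ω} [IsFiniteMeasure μ]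
    {f g : Ω → ℂ} (hf : AllMoments f μ) (hg : AllMoments g μ) :
    AllMoments (fun x => lowerEntry (f x) (g x)) μ := by
  simpa only [lowerEntry, div_eq_inv_mul] using
    (hf.sub (hg.const_mul Complex.I)).const_mul (((√2 : ℝ) : ℂ)⁻¹)

lemma allMoments_matrixOfArray_apply (n : ℕ) (t : ℝ) (i j : Fin n) :
    AllMoments (fun g => matrixOfArray n g i j) (arrayLaw (Fin n) (ellipticLaw t)) := by
  simp only [matrixOfArray, Matrix.of_apply]
  have hentry := allMoments_entry_arrayLaw (ι := Fin n) t
  split_ifs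
  · exact allMoments_upperEntry (hentry i j) (hentry j i)
  · exact allMoments_lowerEntry (hentry j i) (hentry i j)
  · exact hentry i i

lemma allMoments_det_egeLaw (n : ℕ) (t : ℝ) (c w : ℂ) :
    AllMoments (fun A => (c • (1 : Matrix (Fin n) (Fin n) ℂ) - w • A).det) (egeLaw n t) := by
  have h : AllMoments (fun g => (c • 1 - w • matrixOfArray n g).det)
      (arrayLaw (Fin n) (ellipticLaw t)) := by
    simp only [Matrix.det_apply', Matrix.sub_apply, Matrix.smul_apply]
    exact .finset_sum _ fun σ _ => .const_mul _ <| .finset_prod _ fun i _ =>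
      (AllMoments.const _).sub ((allMoments_matrixOfArray_apply n t _ _).const_mul w)
  have hmeas : Measurable fun A => (c • (1 : Matrix (Fin n) (Fin n) ℂ) - w • A).det :=
    measurable_det_smul_one_sub_smul measurable_const measurable_const measurable_id
  rw [egeLaw_eq_map_arrayLaw]
  exact fun p => (memLp_map_measure_iff hmeas.aestronglyMeasurable
    (measurable_matrixOfArray n).aemeasurable).2 (h p)

end MatrixLaw

section CharPolyBlocks

/-- The factor which the diagonal entry `z` contributes to a term of the characteristic polynomial
at `u`. -/
def diagFactor (u : ℂ) (b : Bool) (z : ℂ) : ℂ := if b then u - z else 1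

/-- The factor which a pair of mirror entries contributes to a term of the characteristic
polynomial. -/
def pairFactor (b c : Bool) (x : ℂ × ℂ) : ℂ :=
  (if b then -lowerEntry x.1 x.2 else 1) * if c then -upperEntry x.1 x.2 else 1

lemma measurable_diagFactor (u : ℂ) (b : Bool) : Measurable (diagFactor u b) := by
  unfold diagFactor; split_ifs <;> fun_prop

lemma measurable_pairFactor (b c : Bool) : Measurable (pairFactor b c) := by
  unfold pairFactor lowerEntry upperEntry; split_ifs <;> fun_prop

lemma allMoments_diagFactor {Ω : Type*} [MeasurableSpace Ω] {μ : Measure Ω} [IsFiniteMeasure μ]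
    {f : Ω → ℂ} (hf : AllMoments f μ) (u : ℂ) (b : Bool) :
    AllMoments (fun x => diagFactor u b (f x)) μ := by
  unfold diagFactor
  split_ifs
  exacts [(AllMoments.const u).sub hf, .const 1]

lemma allMoments_pairFactor {Ω : Type*} [MeasurableSpace Ω] {μ : Measure Ω} [IsFiniteMeasure μ]
    {f g : Ω → ℂ} (hf : AllMoments f μ) (hg : AllMoments g μ) (b c : Bool) :
    AllMoments (fun x => pairFactor b c (f x, g x)) μ := by
  have hneg {h : Ω → ℂ} (hh : AllMoments h μ) : AllMoments (fun x => -h x) μ :=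
    fun p => (hh p).neg
  unfold pairFactor
  refine .mul ?_ ?_ <;> split_ifs
  exacts [hneg (allMoments_lowerEntry hf hg), .const 1, hneg (allMoments_upperEntry hf hg),
    .const 1]

lemma integral_diagFactor_mul_conj {t : ℝ} (ht : |t| ≤ 1) (u v : ℂ) (b c : Bool) :
    ∫ z, diagFactor u b z * (starRingEnd ℂ) (diagFactor v c z) ∂ellipticLaw t =
      diagWeight u ((starRingEnd ℂ) v) b c := by
  have h (p₀ p₁ q₀ q₁ : ℂ) := integral_quadratic_mul_quadratic_ellipticLaw ht p₀ p₁ 0 q₀ q₁ 0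
  cases b <;> cases c <;> simp only [diagFactor, diagWeight]
  · simp
  · simpa [sub_eq_add_neg] using h 1 0 ((starRingEnd ℂ) v) (-1)
  · simpa [sub_eq_add_neg] using h u (-1) 1 0
  · simpa [sub_eq_add_neg] using h u (-1) ((starRingEnd ℂ) v) (-1)

lemma integral_pairFactor_mul_conj {t : ℝ} (ht : |t| ≤ 1) (b₁ b₂ c₁ c₂ : Bool) :
    ∫ x, pairFactor b₁ b₂ x * (starRingEnd ℂ) (pairFactor c₁ c₂ x)
        ∂(ellipticLaw t).prod (ellipticLaw t) = pairWeight (t : ℂ) t b₁ b₂ c₁ c₂ := by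
  have hfst := (allMoments_ellipticLaw t).comp_measurePreserving
    (measurePreserving_fst (μ := ellipticLaw t) (ν := ellipticLaw t))
  have hsnd := (allMoments_ellipticLaw t).comp_measurePreserving
    (measurePreserving_snd (μ := ellipticLaw t) (ν := ellipticLaw t))
  rw [integral_prod _ ((allMoments_pairFactor hfst hsnd b₁ b₂).mul
    (allMoments_pairFactor hfst hsnd c₁ c₂).conj).integrable]
  have hpoly (b c : Bool) (z w : ℂ) : pairFactor b c (z, w) =
      (if !b && !c then 1 else 0) + (if !b && c then -1 else 0) * upperEntry z w +
        (if b && !c then -1 else 0) * lowerEntry z w +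
        (if b && c then 1 else 0) * (upperEntry z w * lowerEntry z w) := by
    cases b <;> cases c <;> simp [pairFactor, mul_comm]
  have hconj (p : Prop) [Decidable p] (a : ℂ) :
      (starRingEnd ℂ) (if p then a else 0) = if p then (starRingEnd ℂ) a else 0 := by
    split_ifs <;> simp
  simp only [hpoly, map_add, map_mul (starRingEnd ℂ) (if _ then _ else _), hconj, map_one, map_neg]
  rw [integral_pair_ellipticLaw ht]
  cases b₁ <;> cases b₂ <;> cases c₁ <;> cases c₂ <;> simp [pairWeight, pairMean]

lemma det_smul_one_sub_matrixOfArray {n : ℕ} (u : ℂ) (g : Fin n → Fin n → ℂ) :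
    (u • (1 : Matrix (Fin n) (Fin n) ℂ) - matrixOfArray n g).det =
      signedBlockSum (fun i b => diagFactor u b (g i i))
        fun p b c => pairFactor b c (g p.1 p.2, g p.2 p.1) := by
  rw [det_eq_signedBlockSum]
  simp only [signedBlockSum, blockProd]
  refine Finset.sum_congr rfl fun σ _ => ?_
  congr 2
  · simp [diagFactor, matrixOfArray]
  · refine Finset.prod_congr rfl fun p hp => ?_
    have hlt := mem_upperPairs.1 hp
    simp [pairFactor, matrixOfArray, hlt, hlt.ne, hlt.ne', hlt.not_gt]

variable {ι : Type*} [Fintype ι] [LinearOrder ι]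

/-- The term of the characteristic polynomial at `u` which belongs to the relation `e` between rows
and columns. -/
def charPolyTerm (u : ℂ) (e : ι → ι → Bool) (g : ι → ι → ℂ) : ℂ :=
  blockProd (fun i b => diagFactor u b (g i i))
    (fun p b c => pairFactor b c (g p.1 p.2, g p.2 p.1)) e

lemma allMoments_charPolyTerm (t : ℝ) (u : ℂ) (e : ι → ι → Bool) :
    AllMoments (charPolyTerm u e) (arrayLaw ι (ellipticLaw t)) :=
  .mul (.finset_prod _ fun i _ => allMoments_diagFactor (allMoments_entry_arrayLaw t i i) _ _)
    (.finset_prod _ fun p _ => allMoments_pairFactor (allMoments_entry_arrayLaw t p.1 p.2)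
      (allMoments_entry_arrayLaw t p.2 p.1) _ _)

lemma integral_charPolyTerm_mul_conj {t : ℝ} (ht : |t| ≤ 1) (u v : ℂ) (e e' : ι → ι → Bool) :
    ∫ g, charPolyTerm u e g * (starRingEnd ℂ) (charPolyTerm v e' g) ∂arrayLaw ι (ellipticLaw t) =
      blockProd (fun i b => diagWeight u ((starRingEnd ℂ) v) b (e' i i))
        (fun p b c => pairWeight (t : ℂ) t b c (e' p.1 p.2) (e' p.2 p.1)) e := by
  have hconj : Measurable (starRingEnd ℂ) := Complex.continuous_conj.measurable
  simp only [charPolyTerm, blockProd, map_mul, map_prod, mul_mul_mul_comm (∏ _, _),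
    ← Finset.prod_mul_distrib]
  rw [integral_prod_blocks_arrayLaw
    (f := fun i z => diagFactor u (e i i) z * (starRingEnd ℂ) (diagFactor v (e' i i) z))
    (F := fun p x => pairFactor (e p.1 p.2) (e p.2 p.1) x *
      (starRingEnd ℂ) (pairFactor (e' p.1 p.2) (e' p.2 p.1) x))
    (fun i => (measurable_diagFactor _ _).mul (hconj.comp (measurable_diagFactor _ _)))
    (fun p => (measurable_pairFactor _ _).mul (hconj.comp (measurable_pairFactor _ _)))]
  simp only [integral_diagFactor_mul_conj ht, integral_pairFactor_mul_conj ht]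

end CharPolyBlocks

section SecondMoment

theorem integral_det_mul_conj_det {n : ℕ} {t : ℝ} (ht : |t| ≤ 1) (u v : ℂ) :
    ∫ A, (u • (1 : Matrix (Fin n) (Fin n) ℂ) - A).det *
        (starRingEnd ℂ) (v • (1 : Matrix (Fin n) (Fin n) ℂ) - A).det ∂egeLaw n t =
      hermiteSum n (t : ℂ) t u ((starRingEnd ℂ) v) := by
  let sgn (σ : Equiv.Perm (Fin n)) : ℂ := ((Equiv.Perm.sign σ : ℤ) : ℂ)
  have hdet (w : ℂ) (g : Fin n → Fin n → ℂ) :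
      (w • (1 : Matrix (Fin n) (Fin n) ℂ) - matrixOfArray n g).det =
        ∑ σ : Equiv.Perm (Fin n), sgn σ * charPolyTerm w (permGraph σ) g :=
    det_smul_one_sub_matrixOfArray w g
  have hmeas : Measurable fun A => (u • (1 : Matrix (Fin n) (Fin n) ℂ) - A).det *
      (starRingEnd ℂ) (v • (1 : Matrix (Fin n) (Fin n) ℂ) - A).det := by
    have h (w : ℂ) : Measurable fun A => (w • (1 : Matrix (Fin n) (Fin n) ℂ) - A).det := by
      simpa using measurable_det_smul_one_sub_smul (n := n) measurable_const
        (measurable_const (a := (1 : ℂ))) measurable_id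
    exact (h u).mul (Complex.continuous_conj.measurable.comp (h v))
  have hterm (σ τ : Equiv.Perm (Fin n)) : Integrable (fun g =>
      sgn τ * (sgn σ * (charPolyTerm u (permGraph σ) g *
        (starRingEnd ℂ) (charPolyTerm v (permGraph τ) g)))) (arrayLaw (Fin n) (ellipticLaw t)) :=
    ((((allMoments_charPolyTerm t u _).mul (allMoments_charPolyTerm t v _).conj).const_mul
      _).const_mul _).integrable
  have hsum (g : Fin n → Fin n → ℂ) :
      (u • (1 : Matrix (Fin n) (Fin n) ℂ) - matrixOfArray n g).det *
        (starRingEnd ℂ) (v • (1 : Matrix (Fin n) (Fin n) ℂ) - matrixOfArray n g).det =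
      ∑ τ : Equiv.Perm (Fin n), ∑ σ : Equiv.Perm (Fin n), sgn τ * (sgn σ *
        (charPolyTerm u (permGraph σ) g * (starRingEnd ℂ) (charPolyTerm v (permGraph τ) g))) := by
    simp only [hdet, map_sum, map_mul, sgn, map_intCast, Finset.sum_mul_sum]
    rw [Finset.sum_comm]
    exact Finset.sum_congr rfl fun τ _ => Finset.sum_congr rfl fun σ _ => by ring
  rw [egeLaw_eq_map_arrayLaw, integral_map (measurable_matrixOfArray n).aemeasurable
    hmeas.aestronglyMeasurable]
  simp only [hsum]
  rw [integral_finsetSum _ fun τ _ => integrable_finsetSum _ fun σ _ => hterm σ τ]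
  simp only [integral_finsetSum _ fun σ _ => hterm σ _, integral_const_mul,
    integral_charPolyTerm_mul_conj ht]
  conv_rhs => rw [← Fintype.card_fin n, ← covSum_eq_hermiteSum]
  simp only [covSum, signedBlockSum, Finset.mul_sum, sgn]

lemma hermiteSum_conj (n : ℕ) (t : ℝ) (u : ℂ) :
    hermiteSum n (t : ℂ) t u ((starRingEnd ℂ) u) =
      ((∑ k ∈ Finset.range (n + 1), (n.factorial / k.factorial : ℝ) *
        ‖hermiteVar (t : ℂ) u k‖ ^ 2 : ℝ) : ℂ) := by
  rw [hermiteSum, Complex.ofReal_sum]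
  refine Finset.sum_congr rfl fun k hk => ?_
  have hconj : hermiteVar (t : ℂ) ((starRingEnd ℂ) u) k =
      (starRingEnd ℂ) (hermiteVar (t : ℂ) u k) := by
    rw [map_hermiteVar, Complex.conj_ofReal]
  have hchoose : ((n.choose k * (n - k).factorial : ℕ) : ℂ) = n.factorial / k.factorial := by
    rw [eq_div_iff (by exact_mod_cast k.factorial_ne_zero),
      ← Nat.choose_mul_factorial_mul_factorial (Finset.mem_range_succ_iff.1 hk)]
    push_cast
    ring
  rw [hconj, Complex.mul_conj, Complex.normSq_eq_norm_sq, hchoose]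
  push_cast
  rfl

theorem integral_normSq_det {n : ℕ} {t : ℝ} (ht : |t| ≤ 1) (c w : ℂ) :
    ∫ A, ‖(c • (1 : Matrix (Fin n) (Fin n) ℂ) - w • A).det‖ ^ 2 ∂egeLaw n t =
      ∑ k ∈ Finset.range (n + 1), (n.factorial / k.factorial : ℝ) *
        (‖w‖ ^ (n - k) * ‖hermiteVar (w ^ 2 * t) c k‖) ^ 2 := by
  rcases eq_or_ne w 0 with rfl | hw
  · rw [Finset.sum_eq_single_of_mem n (by simp) fun k hk hkn => ?_]
    · simp [hermiteVar_zero_left, n.factorial_ne_zero]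
    · have hsub : n - k ≠ 0 := by have := Finset.mem_range.1 hk; omega
      simp [hsub]
  have hfactor (A : Matrix (Fin n) (Fin n) ℂ) :
      ((‖(c • (1 : Matrix (Fin n) (Fin n) ℂ) - w • A).det‖ ^ 2 : ℝ) : ℂ) =
        ((‖w‖ ^ n) ^ 2 : ℝ) * (((c / w) • (1 : Matrix (Fin n) (Fin n) ℂ) - A).det *
          (starRingEnd ℂ) ((c / w) • (1 : Matrix (Fin n) (Fin n) ℂ) - A).det) := by
    have hscale : c • (1 : Matrix (Fin n) (Fin n) ℂ) - w • A = w • ((c / w) • 1 - A) := by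
      rw [smul_sub, smul_smul, mul_div_cancel₀ _ hw]
    rw [hscale, Matrix.det_smul, Complex.mul_conj, Complex.normSq_eq_norm_sq, Fintype.card_fin]
    simp [mul_pow]
  apply Complex.ofReal_injective
  rw [← integral_complex_ofReal]
  simp only [hfactor, integral_const_mul, integral_det_mul_conj_det ht, hermiteSum_conj]
  rw [← Complex.ofReal_mul, Finset.mul_sum]
  congr 1
  refine Finset.sum_congr rfl fun k hk => ?_
  have hscale : hermiteVar (w ^ 2 * t) c k = w ^ k * hermiteVar (t : ℂ) (c / w) k := by
    rw [← hermiteVar_scale, mul_div_cancel₀ _ hw]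
  rw [hscale, norm_mul, norm_pow, ← mul_assoc (‖w‖ ^ (n - k)), ← pow_add,
    Nat.sub_add_cancel (Finset.mem_range_succ_iff.1 hk)]
  ring

end SecondMoment

open Complex (I)
open Real (circleAverage)
open scoped Real

section ContourIntegral

lemma circleAverage_inv_pow_mul {f : ℂ → ℂ} (hf : Differentiable ℂ f) (k : ℕ) {R : ℝ}
    (hR : 0 < R) :
    circleAverage (fun w => (w ^ k)⁻¹ * f w) 0 R = iteratedDeriv k f 0 / k.factorial := by
  have hcauchy := hf.diffContOnCl.circleIntegral_one_div_sub_center_pow_smul hR k (c := 0)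
  have hintegrand : ∀ w : ℂ, (w - 0)⁻¹ • ((w ^ k)⁻¹ * f w) = (1 / (w - 0) ^ (k + 1)) • f w :=
    fun w => by rw [sub_zero, smul_eq_mul, smul_eq_mul, one_div, pow_succ', mul_inv, mul_assoc]
  rw [Real.circleAverage_eq_circleIntegral hR.ne', funext hintegrand, hcauchy]
  have hpi : (π : ℂ) ≠ 0 := by exact_mod_cast Real.pi_ne_zero
  have hI := Complex.I_ne_zero
  simp only [smul_eq_mul]
  field_simp

lemma circleAverage_eq_integral_neg_pi_pi {E : Type*} [NormedAddCommGroup E] [NormedSpace ℝ E]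
    (f : ℂ → E) (c : ℂ) (R : ℝ) :
    circleAverage f c R = (2 * π)⁻¹ • ∫ θ in (-π)..π, f (circleMap c R θ) := by
  rw [Real.circleAverage_eq_integral_add (-π),
    intervalIntegral.integral_comp_add_right fun θ => f (circleMap c R θ)]
  ring_nf

end ContourIntegral

section Phase

/-- The entire function `exp (n (w - a (w - 1)² / 2))`, which generates the Hermite polynomials of
the second moment; its modulus on the unit circle peaks at the saddle point `w = 1`. -/
def phase (n : ℕ) (a w : ℂ) : ℂ := Complex.exp (n * (w - a / 2 * (w - 1) ^ 2))

/-- The `k`-th Taylor coefficient of `phase n a` at the origin. -/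
def phaseCoeff (n : ℕ) (a : ℂ) (k : ℕ) : ℂ :=
  hermiteVar (n * a) (n * (1 + a)) k * Complex.exp (-(n * a) / 2) / k.factorial

@[fun_prop]
lemma differentiable_phase (n : ℕ) (a : ℂ) : Differentiable ℂ (phase n a) := by
  unfold phase
  fun_prop

lemma hasDerivAt_hermiteVar_succ (t u : ℂ) (k : ℕ) :
    HasDerivAt (fun u => hermiteVar t u (k + 1)) ((k + 1) * hermiteVar t u k) u := by
  open Polynomial in
  have heval : ∀ k v, (hermiteVar (C t) X k : ℂ[X]).eval v = hermiteVar t v k := fun k v => by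
    simpa using map_hermiteVar (Polynomial.evalRingHom v) (C t) X k
  have hderiv := derivation_hermiteVar_succ (𝕜 := ℂ) Polynomial.derivative' (t := Polynomial.C t)
    (u := Polynomial.X) (by simp) (by simp) k
  have h := (hermiteVar (Polynomial.C t) Polynomial.X (k + 1)).hasDerivAt u
  rw [← Polynomial.derivative'_apply, hderiv] at h
  simpa [heval] using h

lemma hasDerivAt_phase (n : ℕ) (a w : ℂ) :
    HasDerivAt (phase n a) ((n * (1 + a) - n * a * w) * phase n a w) w := by
  have hexponent : HasDerivAt (fun w : ℂ => (n : ℂ) * (w - a / 2 * (w - 1) ^ 2))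
      (n * (1 - a / 2 * (2 * (w - 1)))) w := by
    simpa using ((hasDerivAt_id w).sub
      ((((hasDerivAt_id w).sub_const 1).pow 2).const_mul (a / 2))).const_mul (n : ℂ)
  exact hexponent.cexp.congr_deriv (by rw [phase]; ring)

lemma iteratedDeriv_phase (n : ℕ) (a : ℂ) (k : ℕ) :
    iteratedDeriv k (phase n a) =
      fun w => hermiteVar (n * a) (n * (1 + a) - n * a * w) k * phase n a w := by
  induction k with
  | zero => simp [hermiteVar]
  | succ k ih =>
    ext w
    rw [iteratedDeriv_succ, ih]
    cases k with
    | zero => simpa [hermiteVar] using (hasDerivAt_phase n a w).deriv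
    | succ k =>
      have haffine : HasDerivAt (fun w : ℂ => n * (1 + a) - n * a * w) (-(n * a)) w := by
        simpa using ((hasDerivAt_id w).const_mul (n * a : ℂ)).const_sub (n * (1 + a) : ℂ)
      have hhermite := (hasDerivAt_hermiteVar_succ (n * a) _ k).comp w haffine
      refine (hhermite.mul (hasDerivAt_phase n a w)).deriv.trans ?_
      rw [hermiteVar_add_two, Function.comp_apply]
      ring

lemma phaseCoeff_eq_circleAverage (n : ℕ) (a : ℂ) (k : ℕ) {R : ℝ} (hR : 0 < R) :
    phaseCoeff n a k = circleAverage (fun w => (w ^ k)⁻¹ * phase n a w) 0 R := by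
  rw [circleAverage_inv_pow_mul (differentiable_phase n a) k hR, iteratedDeriv_phase, phaseCoeff]
  simp only [phase]
  ring_nf

lemma norm_phase_le (n : ℕ) (a w : ℂ) :
    ‖phase n a w‖ ≤ Real.exp (n * (w.re + ‖a‖ / 2 * ‖w - 1‖ ^ 2)) := by
  rw [phase, Complex.norm_exp, Real.exp_le_exp, ← Complex.ofReal_natCast, Complex.re_ofReal_mul,
    Complex.sub_re]
  have hre := (neg_le_abs _).trans (Complex.abs_re_le_norm (a / 2 * (w - 1) ^ 2))
  rw [norm_mul, norm_div, norm_pow, Complex.norm_two] at hre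
  gcongr
  linarith

lemma norm_phase_circleMap_le (n : ℕ) {a : ℂ} (ha : ‖a‖ ≤ 1) {R θ : ℝ} (hR : 0 ≤ R)
    (hθ : |θ| ≤ π) :
    ‖phase n a (circleMap 0 R θ)‖ ≤ Real.exp (n * (1 + R ^ 2) / 2) *
      Real.exp (-(n * (1 - ‖a‖) * R * (2 / π ^ 2)) * θ ^ 2) := by
  have hre : (circleMap 0 R θ).re = R * Real.cos θ := by
    simp [circleMap, Complex.exp_ofReal_mul_I_re]
  have hdist : ‖circleMap 0 R θ - 1‖ ^ 2 = R ^ 2 - 2 * (R * Real.cos θ) + 1 := by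
    rw [norm_sub_sq_real, norm_circleMap_zero, abs_of_nonneg hR, norm_one, one_pow, ← hre]
    simp
  refine (norm_phase_le n a _).trans ?_
  rw [← Real.exp_add, Real.exp_le_exp, hre, hdist]
  have hcos : 0 ≤ (1 - ‖a‖) * R * (1 - 2 / π ^ 2 * θ ^ 2 - Real.cos θ) :=
    mul_nonneg (mul_nonneg (by linarith) hR) (by linarith [Real.cos_le_one_sub_mul_cos_sq hθ])
  have hsq : 0 ≤ (1 - ‖a‖) * (1 - R) ^ 2 := mul_nonneg (by linarith) (sq_nonneg _)
  have hn : (0 : ℝ) ≤ n := n.cast_nonneg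
  nlinarith [mul_nonneg hn hcos, mul_nonneg hn hsq]

lemma norm_phaseCoeff_le {n : ℕ} (hn : 0 < n) {a : ℂ} (ha : ‖a‖ < 1) (k : ℕ) {R : ℝ}
    (hR : 0 < R) :
    ‖phaseCoeff n a k‖ ≤ (2 * π)⁻¹ * ((R ^ k)⁻¹ * Real.exp (n * (1 + R ^ 2) / 2) *
      √(π / (n * (1 - ‖a‖) * R * (2 / π ^ 2)))) := by
  set b : ℝ := n * (1 - ‖a‖) * R * (2 / π ^ 2)
  have hb_pos : 0 < b := by
    have := sub_pos.2 ha
    positivity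
  have hpi : -π ≤ π := by linarith [Real.pi_pos]
  have hgauss := (integrable_exp_neg_mul_sq hb_pos).const_mul
    ((R ^ k)⁻¹ * Real.exp (n * (1 + R ^ 2) / 2))
  have hbound : ∀ θ ∈ Set.Ioc (-π) π,
      ‖(circleMap 0 R θ ^ k)⁻¹ * phase n a (circleMap 0 R θ)‖ ≤
        (R ^ k)⁻¹ * Real.exp (n * (1 + R ^ 2) / 2) * Real.exp (-b * θ ^ 2) := fun θ hθ => by
    rw [norm_mul, norm_inv, norm_pow, norm_circleMap_zero, abs_of_pos hR, mul_assoc]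
    gcongr
    exact norm_phase_circleMap_le n ha.le hR.le (abs_le.2 ⟨hθ.1.le, hθ.2⟩)
  rw [phaseCoeff_eq_circleAverage n a k hR, circleAverage_eq_integral_neg_pi_pi, norm_smul,
    Real.norm_of_nonneg (by positivity), ← integral_gaussian, ← integral_const_mul]
  gcongr
  refine (intervalIntegral.norm_integral_le_of_norm_le hpi (.of_forall hbound)
    hgauss.intervalIntegrable).trans ?_
  rw [intervalIntegral.integral_of_le hpi]
  exact setIntegral_le_integral hgauss (.of_forall fun θ => by positivity)

lemma norm_phaseCoeff_sq_le {n : ℕ} (hn : 0 < n) {a : ℂ} (ha : ‖a‖ < 1) (k : ℕ) :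
    ‖phaseCoeff n a k‖ ^ 2 ≤ (n / (k + 1 : ℕ)) ^ k * (Real.exp n * Real.exp (k + 1 : ℕ)) /
      (√n * √(k + 1 : ℕ) * (1 - ‖a‖)) := by
  set m := k + 1
  have hn' : (0 : ℝ) < n := by exact_mod_cast hn
  have hm' : (0 : ℝ) < m := by positivity
  have ha' : 0 < 1 - ‖a‖ := sub_pos.2 ha
  -- The critical radius of the bound below is close to `√(k / n)`; taking `k + 1` instead of `k`
  -- keeps it positive and turns `k! / k ^ k` into `m! / m ^ m` in the second moment.
  set R : ℝ := √m / √n with hR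
  have hR_pos : 0 < R := by positivity
  have hR_sq : R ^ 2 = m / n := by rw [hR, div_pow, Real.sq_sqrt hm'.le, Real.sq_sqrt hn'.le]
  have hnR : n * R = √n * √m := by
    rw [hR, ← mul_div_assoc, mul_div_right_comm, Real.div_sqrt]
  have hexp : Real.exp (n * (1 + R ^ 2) / 2) ^ 2 = Real.exp n * Real.exp m := by
    rw [← Real.exp_nat_mul, ← Real.exp_add, hR_sq]
    congr 1
    push_cast
    field_simp
  calc ‖phaseCoeff n a k‖ ^ 2
      ≤ ((2 * π)⁻¹ * ((R ^ k)⁻¹ * Real.exp (n * (1 + R ^ 2) / 2) *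
        √(π / (n * (1 - ‖a‖) * R * (2 / π ^ 2))))) ^ 2 := by
        gcongr
        exact norm_phaseCoeff_le hn ha k hR_pos
    _ = π / 8 * ((((R ^ 2)⁻¹) ^ k) * Real.exp (n * (1 + R ^ 2) / 2) ^ 2 /
        (n * R * (1 - ‖a‖))) := by
        rw [mul_pow, mul_pow _ (√_), Real.sq_sqrt (by positivity), mul_pow (R ^ k)⁻¹, ← inv_pow,
          ← pow_mul, mul_comm k, pow_mul, inv_pow R]
        field_simp
        norm_num
    _ ≤ 1 * ((((R ^ 2)⁻¹) ^ k) * Real.exp (n * (1 + R ^ 2) / 2) ^ 2 /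
        (n * R * (1 - ‖a‖))) := by
        gcongr
        linarith [Real.pi_le_four]
    _ = _ := by rw [one_mul, hexp, hR_sq, inv_div, hnR]

end Phase

section MomentTerm

lemma factorial_mul_exp_le {m : ℕ} (hm : 0 < m) :
    (m.factorial : ℝ) * Real.exp m ≤ Real.exp 1 * √m * (m : ℝ) ^ m := by
  obtain ⟨k, rfl⟩ := Nat.exists_eq_succ_of_ne_zero hm.ne'
  have h := Stirling.stirlingSeq'_antitone (Nat.zero_le k)
  rw [Function.comp_apply, Function.comp_apply, Stirling.stirlingSeq_one, Stirling.stirlingSeq,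
    div_le_iff₀ (by positivity), div_pow, ← Real.exp_nat_mul, mul_one,
    Real.sqrt_mul (by norm_num)] at h
  calc _ ≤ Real.exp 1 / √2 * (√2 * √k.succ * (k.succ ^ k.succ / Real.exp k.succ)) *
        Real.exp k.succ := by gcongr
    _ = _ := by field_simp

/-- The summand of the second moment of the normalised characteristic polynomial which carries the
Hermite polynomial of degree `n - j`, for `a = t z²` and `x = |z|²`. It is extended by zero to
`j > n`, so that the second moment is a series over all `j`. -/
def momentTerm (n : ℕ) (a : ℂ) (x : ℝ) (j : ℕ) : ℝ :=
  if j ≤ n then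
    x ^ j * (n.factorial * (n - j).factorial / (n : ℝ) ^ (n + (n - j))) *
      ‖phaseCoeff n a (n - j)‖ ^ 2
  else 0

lemma momentTerm_nonneg (n : ℕ) (a : ℂ) {x : ℝ} (hx : 0 ≤ x) (j : ℕ) :
    0 ≤ momentTerm n a x j := by
  unfold momentTerm
  split_ifs <;> positivity

lemma momentTerm_le {n : ℕ} (hn : 0 < n) {a : ℂ} (ha : ‖a‖ < 1) {x : ℝ} (hx : 0 ≤ x) (j : ℕ) :
    momentTerm n a x j ≤ Real.exp 1 ^ 2 / (1 - ‖a‖) * x ^ j := by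
  have ha' : 0 < 1 - ‖a‖ := sub_pos.2 ha
  unfold momentTerm
  split_ifs
  swap
  · positivity
  set k := n - j
  calc x ^ j * (n.factorial * k.factorial / (n : ℝ) ^ (n + k)) * ‖phaseCoeff n a k‖ ^ 2
      ≤ x ^ j * (n.factorial * k.factorial / (n : ℝ) ^ (n + k)) *
        ((n / (k + 1 : ℕ)) ^ k * (Real.exp n * Real.exp (k + 1 : ℕ)) /
          (√n * √(k + 1 : ℕ) * (1 - ‖a‖))) := by
        gcongr
        exact norm_phaseCoeff_sq_le hn ha k
    _ = x ^ j * ((n.factorial * Real.exp n) * ((k + 1).factorial * Real.exp (k + 1 : ℕ)) /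
        ((√n * (n : ℝ) ^ n) * (√(k + 1 : ℕ) * ((k + 1 : ℕ) : ℝ) ^ (k + 1)) * (1 - ‖a‖))) := by
        rw [Nat.factorial_succ, Nat.cast_mul, pow_add, pow_succ ((k + 1 : ℕ) : ℝ), div_pow]
        field_simp
    _ ≤ x ^ j * ((Real.exp 1 * √n * (n : ℝ) ^ n) *
        (Real.exp 1 * √(k + 1 : ℕ) * ((k + 1 : ℕ) : ℝ) ^ (k + 1)) /
        ((√n * (n : ℝ) ^ n) * (√(k + 1 : ℕ) * ((k + 1 : ℕ) : ℝ) ^ (k + 1)) * (1 - ‖a‖))) := by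
        gcongr x ^ j * (?_ * ?_ / _)
        · exact factorial_mul_exp_le hn
        · exact factorial_mul_exp_le k.succ_pos
    _ = Real.exp 1 ^ 2 / (1 - ‖a‖) * x ^ j := by field_simp

end MomentTerm

section MomentFormula

lemma integrable_normSq_normCharPoly (n : ℕ) (t : ℝ) (z : ℂ) :
    Integrable (fun A => ‖normCharPoly n t A z‖ ^ 2) (egeLaw n t) := by
  have h := (allMoments_det_egeLaw n t (1 + t * z ^ 2) (z / ((√n : ℝ) : ℂ))).const_mul
    (Complex.exp (-(n * t * z ^ 2) / 2)) 2
  simpa only [normCharPoly, mul_comm (Complex.exp _), ENNReal.coe_ofNat] using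
    (memLp_two_iff_integrable_sq_norm h.aestronglyMeasurable).1 h

lemma norm_phaseCoeff_sq {n : ℕ} (hn : 0 < n) (a : ℂ) (k : ℕ) :
    ‖phaseCoeff n a k‖ ^ 2 = ((n : ℝ) ^ k / k.factorial) ^ 2 *
      ‖hermiteVar (a / n) (1 + a) k * Complex.exp (-(n * a) / 2)‖ ^ 2 := by
  have hn' : (n : ℂ) ≠ 0 := by exact_mod_cast hn.ne'
  have hscale := hermiteVar_scale (n : ℂ) (a / n) (1 + a) k
  rw [show (n : ℂ) ^ 2 * (a / n) = n * a by field_simp] at hscale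
  rw [phaseCoeff, hscale, mul_assoc, mul_div_right_comm, norm_mul, norm_div, norm_pow,
    Complex.norm_natCast, Complex.norm_natCast, mul_pow]

theorem integral_normSq_normCharPoly {n : ℕ} (hn : 0 < n) {t : ℝ} (ht : |t| ≤ 1) (z : ℂ) :
    ∫ A, ‖normCharPoly n t A z‖ ^ 2 ∂egeLaw n t =
      ∑ j ∈ Finset.range (n + 1), momentTerm n (t * z ^ 2) (‖z‖ ^ 2) j := by
  have hn' : (0 : ℝ) < n := by exact_mod_cast hn
  set w : ℂ := z / ((√n : ℝ) : ℂ) with hw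
  have hw_sq : w ^ 2 = z ^ 2 / n := by
    rw [hw, div_pow, ← Complex.ofReal_pow, Real.sq_sqrt hn'.le, Complex.ofReal_natCast]
  have hw_norm : ‖w‖ ^ 2 = ‖z‖ ^ 2 / n := by
    rw [← norm_pow, hw_sq, norm_div, norm_pow, Complex.norm_natCast]
  simp only [normCharPoly, norm_mul _ (Complex.exp _), mul_pow _ (‖Complex.exp _‖)]
  rw [integral_mul_const, integral_normSq_det ht, Finset.sum_mul,
    ← Finset.sum_range_reflect (momentTerm n _ _)]
  refine Finset.sum_congr rfl fun k hk => ?_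
  have hkn : k ≤ n := by simpa [Nat.lt_succ_iff] using hk
  rw [momentTerm, if_pos (by omega), show n + 1 - 1 - k = n - k by omega, Nat.sub_sub_self hkn,
    norm_phaseCoeff_sq hn, ← hw, hw_sq, show z ^ 2 / n * t = t * z ^ 2 / n by ring, norm_mul,
    mul_pow, mul_pow, ← pow_mul, mul_comm (n - k), pow_mul, hw_norm, mul_assoc (n : ℂ), div_pow]
  have hpow : (n : ℝ) ^ n = n ^ (n - k) * n ^ k := by rw [← pow_add, Nat.sub_add_cancel hkn]
  rw [pow_add, hpow]
  field_simp

end MomentFormula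

section ExpExpansion

variable {ι : Type*} {l : Filter ι} {m y : ι → ℂ} {L : ℂ}

lemma tendsto_mul_exp_sub_one_sub (hy : Tendsto y l (𝓝 0))
    (hmy : Tendsto (fun i => m i * y i ^ 2) l (𝓝 L)) :
    Tendsto (fun i => m i * (Complex.exp (y i) - 1 - y i)) l (𝓝 (L / 2)) := by
  have hremainder : Tendsto (fun i => m i * (Complex.exp (y i) - 1 - y i - y i ^ 2 / 2)) l
      (𝓝 0) := by
    have h := (Complex.exp_sub_sum_range_succ_isLittleO_pow 2).comp_tendsto hy
    have hmul := (Asymptotics.isBigO_refl m l).mul_isLittleO h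
    refine ((Asymptotics.isLittleO_one_iff ℂ).1
      (hmul.trans_isBigO (hmy.isBigO_one ℂ))).congr fun i => ?_
    have htaylor : ∑ k ∈ Finset.range 3, y i ^ k / (k.factorial : ℂ) = 1 + y i + y i ^ 2 / 2 := by
      simp [Finset.sum_range_succ]
    rw [Function.comp_apply, htaylor]
    ring
  have h := hremainder.add (hmy.div_const 2)
  rw [zero_add] at h
  exact h.congr fun i => by ring

lemma tendsto_mul_exp_sub_one_sq (hy : Tendsto y l (𝓝 0))
    (hmy : Tendsto (fun i => m i * y i ^ 2) l (𝓝 L)) :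
    Tendsto (fun i => m i * (Complex.exp (y i) - 1) ^ 2) l (𝓝 L) := by
  have hy_double : Tendsto (fun i => 2 * y i) l (𝓝 0) := by simpa using hy.const_mul 2
  have hmy_double : Tendsto (fun i => m i * (2 * y i) ^ 2) l (𝓝 (4 * L)) :=
    (hmy.const_mul 4).congr fun i => by ring
  have h := (tendsto_mul_exp_sub_one_sub hy_double hmy_double).sub
    ((tendsto_mul_exp_sub_one_sub hy hmy).const_mul 2)
  rw [show 4 * L / 2 - 2 * (L / 2) = L by ring] at h
  refine h.congr fun i => ?_
  rw [two_mul (y i), Complex.exp_add]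
  ring

end ExpExpansion

section Limit

/-- The integrand of the contour integral for `√n * exp (-n) * phaseCoeff n a (n - j)` over the
unit circle, in the variable `s = √n * θ` at the scale of the saddle point. -/
def saddleKernel (n : ℕ) (a : ℂ) (j : ℕ) : ℝ → ℂ :=
  (Set.Ioc (-π * √n) (π * √n)).indicator fun s =>
    Complex.exp (-n) * ((circleMap 0 1 (s / √n) ^ (n - j))⁻¹ * phase n a (circleMap 0 1 (s / √n)))

lemma measurable_saddleKernel (n : ℕ) (a : ℂ) (j : ℕ) : Measurable (saddleKernel n a j) := by
  have hcircle : Measurable fun s : ℝ => circleMap 0 1 (s / √n) :=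
    (continuous_circleMap 0 1).measurable.comp (measurable_id.div_const _)
  exact (((hcircle.pow_const _).inv.mul ((differentiable_phase n a).continuous.measurable.comp
    hcircle)).const_mul _).indicator measurableSet_Ioc

lemma integral_saddleKernel {n : ℕ} (hn : 0 < n) (a : ℂ) (j : ℕ) :
    (√n : ℝ) * Complex.exp (-n) * phaseCoeff n a (n - j) =
      (2 * π : ℂ)⁻¹ * ∫ s, saddleKernel n a j s := by
  have hn' : (0 : ℝ) < √n := by positivity
  have hle : -π * √n ≤ π * √n := by nlinarith [Real.pi_pos]
  unfold saddleKernel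
  rw [integral_indicator measurableSet_Ioc, ← intervalIntegral.integral_of_le hle,
    intervalIntegral.integral_const_mul, intervalIntegral.integral_comp_div
      (fun θ => (circleMap 0 1 θ ^ (n - j))⁻¹ * phase n a (circleMap 0 1 θ)) hn'.ne',
    mul_div_cancel_right₀ _ hn'.ne', mul_div_cancel_right₀ _ hn'.ne',
    phaseCoeff_eq_circleAverage n a (n - j) one_pos, circleAverage_eq_integral_neg_pi_pi,
    Complex.real_smul, Complex.real_smul]
  push_cast
  ring

lemma norm_saddleKernel_le {n : ℕ} (hn : 0 < n) {a : ℂ} {x : ℝ} (hx : x ≤ 1) (ha : ‖a‖ ≤ x)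
    (j : ℕ) (s : ℝ) :
    ‖saddleKernel n a j s‖ ≤ Real.exp (-((1 - x) * (2 / π ^ 2)) * s ^ 2) := by
  have hn' : (0 : ℝ) < n := by exact_mod_cast hn
  have hsqrt : 0 < √(n : ℝ) := Real.sqrt_pos.2 hn'
  rw [saddleKernel, norm_indicator_eq_indicator_norm]
  refine Set.indicator_apply_le' (fun hs => ?_) fun _ => (Real.exp_pos _).le
  have hθ : |s / √n| ≤ π :=
    abs_le.2 ⟨(le_div_iff₀ hsqrt).2 hs.1.le, (div_le_iff₀ hsqrt).2 hs.2⟩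
  calc ‖Complex.exp (-n) * ((circleMap 0 1 (s / √n) ^ (n - j))⁻¹ *
        phase n a (circleMap 0 1 (s / √n)))‖
      = Real.exp (-n) * ‖phase n a (circleMap 0 1 (s / √n))‖ := by
        simp [Complex.norm_exp]
    _ ≤ Real.exp (-n) * (Real.exp (n * (1 + 1 ^ 2) / 2) *
        Real.exp (-(n * (1 - ‖a‖) * 1 * (2 / π ^ 2)) * (s / √n) ^ 2)) := by
        gcongr
        exact norm_phase_circleMap_le n (ha.trans hx) zero_le_one hθ
    _ = Real.exp (-((1 - ‖a‖) * (2 / π ^ 2)) * s ^ 2) := by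
        rw [div_pow, Real.sq_sqrt hn'.le, ← Real.exp_add, ← Real.exp_add]
        congr 1
        field_simp
        ring
    _ ≤ _ := by
        simp only [neg_mul]
        gcongr

variable {ι : Type*} {l : Filter ι} {n : ι → ℕ} {a : ι → ℂ} {a₀ : ℂ}

lemma tendsto_sqrt_natCast_atTop (hn : Tendsto n l atTop) :
    Tendsto (fun i => √(n i : ℝ)) l atTop :=
  Real.tendsto_sqrt_atTop.comp (tendsto_natCast_atTop_atTop.comp hn)

lemma tendsto_saddleKernel (hn : Tendsto n l atTop) (ha : Tendsto a l (𝓝 a₀)) (j : ℕ) (s : ℝ) :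
    Tendsto (fun i => saddleKernel (n i) (a i) j s) l
      (𝓝 (Complex.exp (-((1 - a₀) / 2) * (s : ℂ) ^ 2))) := by
  have hsqrt := tendsto_sqrt_natCast_atTop hn
  set y : ι → ℂ := fun i => (s / √(n i) : ℝ) * I with hy_def
  have hy : Tendsto y l (𝓝 0) := by
    simpa [hy_def] using (Complex.continuous_ofReal.tendsto _).comp (hsqrt.const_div_atTop s)
      |>.mul_const I
  have hny : Tendsto (fun i => (n i : ℂ) * y i ^ 2) l (𝓝 (-(s : ℂ) ^ 2)) := by
    refine tendsto_const_nhds.congr' ?_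
    filter_upwards [hn.eventually_gt_atTop 0] with i hi
    have hi' : (n i : ℂ) ≠ 0 := by exact_mod_cast hi.ne'
    rw [hy_def, mul_pow, Complex.I_sq, ← Complex.ofReal_pow (s / _), div_pow,
      Real.sq_sqrt (by positivity)]
    push_cast
    field_simp
  have hexponent := (((tendsto_mul_exp_sub_one_sub hy hny).sub
    ((ha.div_const 2).mul (tendsto_mul_exp_sub_one_sq hy hny))).add (hy.mul_const (j : ℂ))).cexp
  rw [show -(s : ℂ) ^ 2 / 2 - a₀ / 2 * -(s : ℂ) ^ 2 + 0 * j = -((1 - a₀) / 2) * (s : ℂ) ^ 2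
    by ring] at hexponent
  refine hexponent.congr' ?_
  filter_upwards [hn.eventually_ge_atTop j,
    (hsqrt.const_mul_atTop Real.pi_pos).eventually_gt_atTop |s|] with i hj hs
  have hmem : s ∈ Set.Ioc (-π * √(n i)) (π * √(n i)) := by
    have := abs_lt.1 hs
    exact ⟨by linarith, this.2.le⟩
  have hcircle : circleMap 0 1 (s / √(n i)) = Complex.exp (y i) := by simp [circleMap, hy_def]
  rw [saddleKernel, Set.indicator_of_mem hmem, hcircle, phase, ← Complex.exp_nat_mul,
    ← Complex.exp_neg, ← Complex.exp_add, ← Complex.exp_add, Nat.cast_sub hj]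
  congr 1
  ring

lemma tendsto_phaseCoeff [l.IsCountablyGenerated] (hn : Tendsto n l atTop)
    (ha : Tendsto a l (𝓝 a₀)) (ha₀ : ‖a₀‖ < 1) (j : ℕ) :
    Tendsto (fun i => (√(n i) : ℝ) * Complex.exp (-n i) * phaseCoeff (n i) (a i) (n i - j)) l
      (𝓝 ((2 * π : ℂ)⁻¹ * (π / ((1 - a₀) / 2)) ^ (1 / 2 : ℂ))) := by
  obtain ⟨x, hx, hx_lt⟩ := exists_between ha₀
  have hre : 0 < ((1 - a₀) / 2).re := by
    have := (le_abs_self _).trans (Complex.abs_re_le_norm a₀)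
    simp
    linarith
  have hrate : 0 < (1 - x) * (2 / π ^ 2) :=
    mul_pos (sub_pos.2 hx_lt) (by positivity)
  have hn_pos := hn.eventually_gt_atTop 0
  have ha_le : ∀ᶠ i in l, ‖a i‖ ≤ x := ha.norm.eventually (eventually_le_nhds hx)
  have h := tendsto_integral_filter_of_dominated_convergence (μ := volume) (l := l)
    (F := fun i => saddleKernel (n i) (a i) j)
    (fun s => Real.exp (-((1 - x) * (2 / π ^ 2)) * s ^ 2))
    (.of_forall fun i => (measurable_saddleKernel (n i) (a i) j).aestronglyMeasurable)
    (by
      filter_upwards [hn_pos, ha_le] with i hi hai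
      exact .of_forall (norm_saddleKernel_le hi hx_lt.le hai j))
    (integrable_exp_neg_mul_sq hrate)
    (.of_forall (tendsto_saddleKernel hn ha j))
  rw [integral_gaussian_complex hre] at h
  refine (h.const_mul (2 * π : ℂ)⁻¹).congr' ?_
  filter_upwards [hn_pos] with i hi
  exact (integral_saddleKernel hi (a i) j).symm

lemma tendsto_factorial_sub_mul_pow_div_factorial (j : ℕ) :
    Tendsto (fun n : ℕ => ((n - j).factorial : ℝ) * (n : ℝ) ^ j / n.factorial) atTop (𝓝 1) := by
  have h : Tendsto (fun n : ℕ => ((n.descFactorial j : ℕ) : ℝ) / (n : ℝ) ^ j) atTop (𝓝 1) := by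
    refine (Asymptotics.isEquivalent_iff_tendsto_one ?_).1 (isEquivalent_descFactorial j)
    filter_upwards [eventually_gt_atTop 0] with n hn
    positivity
  rw [← inv_one]
  refine (h.inv₀ one_ne_zero).congr' ?_
  filter_upwards [eventually_ge_atTop j] with n hn
  have hfact : ((n - j).factorial : ℝ) ≠ 0 := by exact_mod_cast (n - j).factorial_ne_zero
  rw [inv_div, ← Nat.factorial_mul_descFactorial hn, Nat.cast_mul, mul_div_mul_left _ _ hfact]

lemma momentTerm_eq_stirlingSeq {n : ℕ} (hn : 0 < n) (a : ℂ) (x : ℝ) {j : ℕ} (hj : j ≤ n) :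
    momentTerm n a x j = x ^ j *
      (‖(√n : ℝ) * Complex.exp (-n) * phaseCoeff n a (n - j)‖ ^ 2 *
        (2 * Stirling.stirlingSeq n ^ 2) *
        ((n - j).factorial * (n : ℝ) ^ j / n.factorial)) := by
  have hn' : (0 : ℝ) < n := by exact_mod_cast hn
  have hfact : (n.factorial : ℝ) ≠ 0 := by exact_mod_cast n.factorial_ne_zero
  have hexp : Real.exp 1 ^ n = Real.exp n := by rw [← Real.exp_nat_mul, mul_one]
  have hpow : (n : ℝ) ^ n = n ^ (n - j) * n ^ j := by rw [← pow_add, Nat.sub_add_cancel hj]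
  rw [momentTerm, if_pos hj, mul_assoc, norm_mul, norm_mul, Complex.norm_real, Complex.norm_exp,
    Real.norm_of_nonneg (Real.sqrt_nonneg _), Complex.neg_re, Complex.natCast_re,
    Stirling.stirlingSeq, div_pow, mul_pow, mul_pow, mul_pow, Real.sq_sqrt hn'.le,
    Real.sq_sqrt (by positivity), div_pow, hexp, Real.exp_neg, pow_add, hpow]
  field_simp

lemma tendsto_momentTerm [l.IsCountablyGenerated] (hn : Tendsto n l atTop)
    (ha : Tendsto a l (𝓝 a₀)) (ha₀ : ‖a₀‖ < 1) {x : ι → ℝ} {x₀ : ℝ} (hx : Tendsto x l (𝓝 x₀))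
    (j : ℕ) :
    Tendsto (fun i => momentTerm (n i) (a i) (x i) j) l (𝓝 (x₀ ^ j * ‖1 - a₀‖⁻¹)) := by
  have hcoeff := (tendsto_phaseCoeff hn ha ha₀ j).norm.pow 2
  have hstirling := ((Stirling.tendsto_stirlingSeq_sqrt_pi.pow 2).const_mul 2).comp hn
  have hratio := (tendsto_factorial_sub_mul_pow_div_factorial j).comp hn
  have hlimit := (hx.pow j).mul ((hcoeff.mul hstirling).mul hratio)
  have hne : ‖1 - a₀‖ ≠ 0 := norm_ne_zero_iff.2 (sub_ne_zero.2 fun h => by simp [← h] at ha₀)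
  have hconstant : ‖(2 * π : ℂ)⁻¹ * (π / ((1 - a₀) / 2)) ^ (1 / 2 : ℂ)‖ ^ 2 *
      (2 * √π ^ 2) * 1 = ‖1 - a₀‖⁻¹ := by
    have hsqrt : ((π / ((1 - a₀) / 2) : ℂ) ^ (1 / 2 : ℂ)) ^ 2 = π / ((1 - a₀) / 2) := by
      rw [← Complex.cpow_nat_mul]
      norm_num
    rw [← norm_pow, mul_pow, hsqrt, Real.sq_sqrt Real.pi_pos.le]
    simp only [norm_mul, norm_div, norm_inv, norm_pow, Complex.norm_two, Complex.norm_real,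
      Real.norm_of_nonneg Real.pi_pos.le]
    field_simp
  rw [hconstant] at hlimit
  refine hlimit.congr' ?_
  filter_upwards [hn.eventually_gt_atTop 0, hn.eventually_ge_atTop j] with i hi hij
  exact (momentTerm_eq_stirlingSeq hi (a i) (x i) hij).symm

lemma sum_momentTerm_eq_tsum (n : ℕ) (a : ℂ) (x : ℝ) :
    ∑ j ∈ Finset.range (n + 1), momentTerm n a x j = ∑' j, momentTerm n a x j := by
  refine (tsum_eq_sum fun j hj => ?_).symm
  rw [momentTerm, if_neg (by simpa [Nat.lt_succ_iff] using hj)]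

lemma tendsto_sum_momentTerm [l.IsCountablyGenerated] (hn : Tendsto n l atTop)
    (ha : Tendsto a l (𝓝 a₀)) (ha₀ : ‖a₀‖ < 1) {x : ι → ℝ} {x₀ : ℝ} (hx_nonneg : ∀ i, 0 ≤ x i)
    (hx : Tendsto x l (𝓝 x₀)) (hx₀ : 0 ≤ x₀) (hx₀_lt : x₀ < 1) :
    Tendsto (fun i => ∑ j ∈ Finset.range (n i + 1), momentTerm (n i) (a i) (x i) j) l
      (𝓝 ((1 - x₀)⁻¹ * ‖1 - a₀‖⁻¹)) := by
  obtain ⟨α, hα, hα_lt⟩ := exists_between ha₀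
  obtain ⟨ξ, hξ, hξ_lt⟩ := exists_between hx₀_lt
  simp only [sum_momentTerm_eq_tsum, ← tsum_geometric_of_lt_one hx₀ hx₀_lt, ← tsum_mul_right]
  refine tendsto_tsum_of_dominated_convergence (bound := fun j => Real.exp 1 ^ 2 / (1 - α) * ξ ^ j)
    ((summable_geometric_of_lt_one (hx₀.trans hξ.le) hξ_lt).mul_left _)
    (tendsto_momentTerm hn ha ha₀ hx) ?_
  filter_upwards [hn.eventually_gt_atTop 0, ha.norm.eventually (eventually_le_nhds hα),
    hx.eventually (eventually_le_nhds hξ)] with i hi hαi hξi j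
  have : 0 < 1 - α := sub_pos.2 hα_lt
  have hxi := hx_nonneg i
  rw [Real.norm_of_nonneg (momentTerm_nonneg _ _ hxi j)]
  refine (momentTerm_le hi (hαi.trans_lt hα_lt) hxi j).trans ?_
  gcongr

end Limit

section LimitMoment

/-- The limit `𝓕` of the second moment. -/
def limitMoment (t : ℝ) (z : ℂ) : ℝ := (1 - ‖z‖ ^ 2)⁻¹ * ‖1 - t * z ^ 2‖⁻¹

variable {t : ℝ} {z : ℂ}

lemma norm_mul_sq_le (ht : |t| ≤ 1) (z : ℂ) : ‖t * z ^ 2‖ ≤ ‖z‖ ^ 2 := by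
  rw [norm_mul, norm_pow, Complex.norm_real]
  exact mul_le_of_le_one_left (sq_nonneg _) ht

lemma norm_sq_lt_one (hz : ‖z‖ < 1) : ‖z‖ ^ 2 < 1 :=
  pow_lt_one₀ (norm_nonneg z) hz two_ne_zero

lemma norm_one_sub_mul_sq_pos (ht : |t| ≤ 1) (hz : ‖z‖ < 1) : 0 < ‖1 - t * z ^ 2‖ := by
  refine norm_pos_iff.2 (sub_ne_zero.2 fun h => ?_)
  have := (norm_mul_sq_le ht z).trans_lt (norm_sq_lt_one hz)
  simp [← h] at this

lemma limitMoment_pos (ht : |t| ≤ 1) (hz : ‖z‖ < 1) : 0 < limitMoment t z :=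
  mul_pos (inv_pos.2 (sub_pos.2 (norm_sq_lt_one hz))) (inv_pos.2 (norm_one_sub_mul_sq_pos ht hz))

lemma continuousAt_limitMoment (ht : |t| ≤ 1) (hz : ‖z‖ < 1) :
    ContinuousAt (limitMoment t) z := by
  have h₁ : ContinuousAt (fun z : ℂ => 1 - ‖z‖ ^ 2) z := by fun_prop
  have h₂ : ContinuousAt (fun z : ℂ => ‖1 - t * z ^ 2‖) z := by fun_prop
  exact (h₁.inv₀ (sub_pos.2 (norm_sq_lt_one hz)).ne').mul
    (h₂.inv₀ (norm_one_sub_mul_sq_pos ht hz).ne')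

theorem tendsto_integral_normSq_normCharPoly (ht : |t| ≤ 1) (hz : ‖z‖ < 1) :
    Tendsto (fun p : ℕ × ℂ => ∫ A, ‖normCharPoly p.1 t A p.2‖ ^ 2 ∂egeLaw p.1 t)
      (atTop ×ˢ 𝓝 z) (𝓝 (limitMoment t z)) := by
  have hn : Tendsto (Prod.fst : ℕ × ℂ → ℕ) (atTop ×ˢ 𝓝 z) atTop := tendsto_fst
  have hw : Tendsto (Prod.snd : ℕ × ℂ → ℂ) (atTop ×ˢ 𝓝 z) (𝓝 z) := tendsto_snd
  refine (tendsto_sum_momentTerm hn ((hw.pow 2).const_mul (t : ℂ))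
    ((norm_mul_sq_le ht z).trans_lt (norm_sq_lt_one hz)) (fun _ => sq_nonneg _) (hw.norm.pow 2)
    (sq_nonneg _) (norm_sq_lt_one hz)).congr' ?_
  filter_upwards [hn.eventually_gt_atTop 0] with p hp
  exact (integral_normSq_normCharPoly hp ht p.2).symm

theorem tendstoUniformlyOn_integral_normSq_normCharPoly (ht : |t| ≤ 1) {K : Set ℂ}
    (hK : K ⊆ Metric.ball 0 1) (hK_compact : IsCompact K) :
    TendstoUniformlyOn (fun n z => ∫ A, ‖normCharPoly n t A z‖ ^ 2 ∂egeLaw n t)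
      (limitMoment t) atTop K := by
  refine (tendstoLocallyUniformlyOn_iff_forall_isCompact Metric.isOpen_ball).1
    (Metric.isOpen_ball.tendstoLocallyUniformlyOn_iff_forall_tendsto.2 fun z hz => ?_)
    K hK hK_compact
  rw [mem_ball_zero_iff] at hz
  exact (((continuousAt_limitMoment ht hz).tendsto.comp tendsto_snd).prodMk_nhds
    (tendsto_integral_normSq_normCharPoly ht hz)).mono_right (nhds_le_uniformity _)

end LimitMoment

section MeanValue

variable {E : Type*} [NormedAddCommGroup E]

lemma enorm_circleAverage_le [NormedSpace ℝ E] (f : ℂ → E) (c : ℂ) (R : ℝ) :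
    ‖circleAverage f c R‖ₑ ≤
      ENNReal.ofReal (2 * π)⁻¹ * ∫⁻ θ in Set.Ioc 0 (2 * π), ‖f (circleMap c R θ)‖ₑ := by
  rw [Real.circleAverage_def, enorm_smul, Real.enorm_of_nonneg (by positivity),
    intervalIntegral.integral_of_le (by positivity)]
  gcongr
  exact enorm_integral_le_lintegral_enorm _

lemma enorm_le_lintegral_circle [NormedSpace ℂ E] [CompleteSpace E] {f : ℂ → E} {c z : ℂ}
    {r ρ : ℝ} (hf : DiffContOnCl ℂ f (Metric.ball c ρ)) (hz : z ∈ Metric.closedBall c r)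
    (hrρ : r < ρ) :
    ‖f z‖ₑ ≤ ENNReal.ofReal ((2 * π)⁻¹ * (ρ / (ρ - r))) *
      ∫⁻ θ in Set.Ioc 0 (2 * π), ‖f (circleMap c ρ θ)‖ₑ := by
  rw [Metric.mem_closedBall, dist_eq_norm] at hz
  have hρ : 0 < ρ := ((norm_nonneg _).trans hz).trans_lt hrρ
  have hkernel : ∀ θ, ‖(circleMap c ρ θ - c) / (circleMap c ρ θ - z)‖ ≤ ρ / (ρ - r) := fun θ => by
    have hcircle : ‖circleMap c ρ θ - c‖ = ρ := by simp [circleMap_sub_center, abs_of_pos hρ]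
    have hdist := norm_sub_norm_le (circleMap c ρ θ - c) (z - c)
    rw [hcircle, sub_sub_sub_cancel_right] at hdist
    rw [norm_div, hcircle]
    gcongr
    linarith
  rw [← abs_of_pos hρ] at hf
  have hmean := hf.circleAverage_smul_div
    (by rw [mem_ball_iff_norm, abs_of_pos hρ]; exact hz.trans_lt hrρ)
  rw [← hmean, ENNReal.ofReal_mul (by positivity), mul_assoc,
    ← lintegral_const_mul' _ _ ENNReal.ofReal_ne_top]
  refine (enorm_circleAverage_le _ c ρ).trans ?_
  gcongr with θ
  rw [enorm_smul, ← ofReal_norm (_ / _)]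
  gcongr
  exact hkernel θ

end MeanValue

section Supremum

variable {n : ℕ} {t : ℝ} {z : ℂ}

lemma integral_normSq_normCharPoly_le (hn : 0 < n) (ht : |t| ≤ 1) (hz : ‖z‖ < 1) :
    ∫ A, ‖normCharPoly n t A z‖ ^ 2 ∂egeLaw n t ≤ Real.exp 1 ^ 2 / (1 - ‖z‖ ^ 2) ^ 2 := by
  have hx := norm_sq_lt_one hz
  have ha := norm_mul_sq_le ht z
  have hx_pos : 0 < 1 - ‖z‖ ^ 2 := sub_pos.2 hx
  calc ∫ A, ‖normCharPoly n t A z‖ ^ 2 ∂egeLaw n t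
      = ∑ j ∈ Finset.range (n + 1), momentTerm n (t * z ^ 2) (‖z‖ ^ 2) j :=
        integral_normSq_normCharPoly hn ht z
    _ ≤ ∑ j ∈ Finset.range (n + 1), Real.exp 1 ^ 2 / (1 - ‖z‖ ^ 2) * (‖z‖ ^ 2) ^ j := by
        gcongr with j
        refine (momentTerm_le hn (ha.trans_lt hx) (sq_nonneg _) j).trans ?_
        gcongr
    _ ≤ Real.exp 1 ^ 2 / (1 - ‖z‖ ^ 2) * (1 - ‖z‖ ^ 2)⁻¹ := by
        rw [← Finset.mul_sum, ← tsum_geometric_of_lt_one (sq_nonneg _) hx]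
        gcongr
        exact (summable_geometric_of_lt_one (sq_nonneg _) hx).sum_le_tsum _
          fun j _ => by positivity
    _ = Real.exp 1 ^ 2 / (1 - ‖z‖ ^ 2) ^ 2 := by field_simp

lemma lintegral_enorm_sq_normCharPoly_le (hn : 0 < n) (ht : |t| ≤ 1) (hz : ‖z‖ < 1) :
    ∫⁻ A, ‖normCharPoly n t A z‖ₑ ^ 2 ∂egeLaw n t ≤
      ENNReal.ofReal (Real.exp 1 ^ 2 / (1 - ‖z‖ ^ 2) ^ 2) := by
  simp only [← ofReal_norm, ← ENNReal.ofReal_pow (norm_nonneg _)]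
  rw [← ofReal_integral_eq_lintegral_ofReal (integrable_normSq_normCharPoly n t z)
    (.of_forall fun A => sq_nonneg _)]
  exact ENNReal.ofReal_le_ofReal (integral_normSq_normCharPoly_le hn ht hz)

lemma differentiable_normCharPoly (n : ℕ) (t : ℝ) (A : Matrix (Fin n) (Fin n) ℂ) :
    Differentiable ℂ (normCharPoly n t A) := by
  unfold normCharPoly
  simp only [Matrix.det_apply', Matrix.sub_apply, Matrix.smul_apply, smul_eq_mul]
  fun_prop

lemma measurable_normCharPoly (n : ℕ) (t : ℝ) :
    Measurable fun p : Matrix (Fin n) (Fin n) ℂ × ℂ => normCharPoly n t p.1 p.2 :=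
  (measurable_det_smul_one_sub_smul (by fun_prop) (by fun_prop) measurable_fst).mul (by fun_prop)

theorem lintegral_iSup_normCharPoly_le (hn : 0 < n) (ht : |t| ≤ 1) {r ρ : ℝ} (hρ : 0 < ρ)
    (hrρ : r < ρ) (hρ_lt : ρ < 1) :
    ∫⁻ A, (⨆ z ∈ Metric.closedBall (0 : ℂ) r, ‖normCharPoly n t A z‖ₑ ^ 2) ∂egeLaw n t ≤
      ENNReal.ofReal (ρ / (ρ - r) * (Real.exp 1 ^ 2 / (1 - ρ ^ 2) ^ 2)) := by
  have hr : 0 < ρ - r := sub_pos.2 hrρ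
  set C := ENNReal.ofReal ((2 * π)⁻¹ * (ρ / (ρ - r)))
  have hmeas : Measurable fun p : Matrix (Fin n) (Fin n) ℂ × ℝ =>
      ‖normCharPoly n t p.1 (circleMap 0 ρ p.2)‖ₑ ^ 2 :=
    ((measurable_normCharPoly n t).comp (measurable_fst.prodMk
      ((continuous_circleMap 0 ρ).measurable.comp measurable_snd))).enorm.pow_const 2
  calc _ ≤ ∫⁻ A, C * (∫⁻ θ in Set.Ioc 0 (2 * π), ‖normCharPoly n t A (circleMap 0 ρ θ)‖ₑ ^ 2)
          ∂egeLaw n t := lintegral_mono fun A => iSup₂_le fun z hz => by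
        simpa only [Pi.pow_apply, enorm_pow] using
          enorm_le_lintegral_circle ((differentiable_normCharPoly n t A).pow 2).diffContOnCl hz hrρ
    _ = C * ∫⁻ θ in Set.Ioc 0 (2 * π),
          ∫⁻ A, ‖normCharPoly n t A (circleMap 0 ρ θ)‖ₑ ^ 2 ∂egeLaw n t := by
        rw [lintegral_const_mul' _ _ ENNReal.ofReal_ne_top,
          lintegral_lintegral_swap hmeas.aemeasurable]
    _ ≤ C * ∫⁻ _ in Set.Ioc 0 (2 * π), ENNReal.ofReal (Real.exp 1 ^ 2 / (1 - ρ ^ 2) ^ 2) := by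
        gcongr with θ
        have hcircle : ‖circleMap 0 ρ θ‖ = ρ := by rw [norm_circleMap_zero, abs_of_pos hρ]
        simpa only [hcircle] using
          lintegral_enorm_sq_normCharPoly_le hn ht (hcircle.trans_lt hρ_lt)
    _ = _ := by
        rw [setLIntegral_const, Real.volume_Ioc, sub_zero, ← ENNReal.ofReal_mul (by positivity),
          ← ENNReal.ofReal_mul (by positivity)]
        congr 1
        field_simp

end Supremum

end EllipticGinibre

end

open EllipticGinibre in
theorem mainTheorem4_general {t : ℝ} (ht : |t| ≤ 1) :
    (∀ n z, Integrable (fun A => ‖normCharPoly n t A z‖ ^ 2) (egeLaw n t)) ∧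
    ContinuousOn (limitMoment t) (Metric.ball 0 1) ∧
    (∀ z ∈ Metric.ball (0 : ℂ) 1, 0 < limitMoment t z) ∧
    (∀ K : Set ℂ, K ⊆ Metric.ball 0 1 → IsCompact K →
      TendstoUniformlyOn (fun n z => ∫ A, ‖normCharPoly n t A z‖ ^ 2 ∂egeLaw n t)
        (limitMoment t) atTop K) ∧
    ∀ r : ℝ, r < 1 → ∃ C : ℝ, 0 < C ∧ ∀ n : ℕ, 1 ≤ n →
      ∫⁻ A, (⨆ z ∈ Metric.closedBall (0 : ℂ) r, ‖normCharPoly n t A z‖ₑ ^ 2) ∂egeLaw n t ≤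
        ENNReal.ofReal C := by
  refine ⟨fun n z => integrable_normSq_normCharPoly n t z,
    fun z hz => (continuousAt_limitMoment ht (by simpa using hz)).continuousWithinAt,
    fun z hz => limitMoment_pos ht (by simpa using hz),
    fun K hK hK_compact => tendstoUniformlyOn_integral_normSq_normCharPoly ht hK hK_compact,
    fun r hr => ?_⟩
  obtain ⟨ρ, hρ, hρ_lt⟩ := exists_between (max_lt hr one_pos)
  obtain ⟨hrρ, hρ_pos⟩ := max_lt_iff.1 hρ
  refine ⟨ρ / (ρ - r) * (Real.exp 1 ^ 2 / (1 - ρ ^ 2) ^ 2), ?_,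
    fun n hn => lintegral_iSup_normCharPoly_le hn ht hρ_pos hrρ hρ_lt⟩
  have : 0 < ρ - r := sub_pos.2 hrρ
  have hρ_sq : 0 < 1 - ρ ^ 2 := sub_pos.2 (pow_lt_one₀ hρ_pos.le hρ_lt two_ne_zero)
  positivity

theorem mainTheorem4 (t : ℝ) (ht0 : 0 < t) (ht1 : t ≤ 1) :
    (∀ n : ℕ, 1 ≤ n → ∀ z ∈ Metric.ball (0 : ℂ) 1,
      Integrable (fun A => ‖EllipticGinibre.normCharPoly n t A z‖ ^ 2)
        (EllipticGinibre.egeLaw n t)) ∧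
    (∃ F : ℂ → ℝ,
      ContinuousOn F (Metric.ball (0 : ℂ) 1 \ {0}) ∧
      (∀ z ∈ Metric.ball (0 : ℂ) 1 \ {0}, 0 < F z) ∧
      ∀ K : Set ℂ, K ⊆ Metric.ball (0 : ℂ) 1 \ {0} → IsCompact K →
        TendstoUniformlyOn
          (fun (n : ℕ) (z : ℂ) =>
            ∫ A, ‖EllipticGinibre.normCharPoly n t A z‖ ^ 2 ∂(EllipticGinibre.egeLaw n t))
          F atTop K) ∧
    (∀ r : ℝ, 0 ≤ r → r < 1 → ∃ C : ℝ, 0 < C ∧ ∀ n : ℕ, 1 ≤ n →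
      ∫⁻ A, (⨆ z ∈ Metric.closedBall (0 : ℂ) r, ‖EllipticGinibre.normCharPoly n t A z‖ₑ ^ 2)
        ∂(EllipticGinibre.egeLaw n t) ≤ ENNReal.ofReal C) := by
  obtain ⟨hint, hcont, hpos, hlim, hsup⟩ :=
    mainTheorem4_general (abs_le.2 ⟨by linarith, ht1⟩)
  exact ⟨fun n _ z _ => hint n z, ⟨EllipticGinibre.limitMoment t, hcont.mono Set.sdiff_subset,
    fun z hz => hpos z hz.1, fun K hK => hlim K (hK.trans Set.sdiff_subset)⟩, fun r _ => hsup r⟩
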